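/- Let $\mathit{Prop}$ be a set of propositional variables and $\mathcal D$ a set of data values. A data word (data $\omega$-word) $w$ is a finite word (an $\omega$-word) in which each position carries the set of propositional variables true there and a data value from $\mathcal D$. Position $j$ is the class successor of $i$, and $i$ the class predecessor of $j$, if $j$ is the least position after $i$ with the same data value as $i$. The $\mu$-calculus on data words has the formulas $$\varphi ::= x \mid A \mid \neg A \mid \mathtt M\varphi \mid \varphi\vee\varphi \mid \varphi\wedge\varphi \mid \mu x.\varphi \mid \nu x.\varphi,$$ where $x$ is a fixpoint variable, $\mathtt M\in\{\mathtt X^g,\mathtt X^c,\mathtt Y^g,\mathtt Y^c\}$, and $A$ is a propositional variable or one of $\mathsf S,\mathsf P,\mathsf{first}^c,\mathsf{first}^g,\mathsf{last}^c,\mathsf{last}^g$. Formulas are identified up to renaming of bound variables. Given sets of positions for the free variables, a formula denotes a set of positions of $w$: $\mathtt X^g\varphi$, $\mathtt X^c\varphi$, $\mathtt Y^g\varphi$, $\mathtt Y^c\varphi$ hold at a position if its successor, class successor, predecessor, class predecessor, respectively, exists and satisfies $\varphi$; $\mathsf S$ ($\mathsf P$) holds if the successor and class successor (predecessor and class predecessor)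 exist and coincide; $\mathsf{first}^g,\mathsf{last}^g,\mathsf{first}^c,\mathsf{last}^c$ hold at positions without predecessor, successor, class predecessor, class successor, respectively; $\mu$ and $\nu$ are least and greatest fixpoints. Two formulas are equivalent over data words and data $\omega$-words if they denote the same set of positions in every data word and every data $\omega$-word, for every valuation of the free variables. For a set $\Psi$ of formulas put $\mathsf{Comp}^0(\Psi)=\emptyset$, and let $\mathsf{Comp}^{i+1}(\Psi)$ be the set of formulas $\psi(\varphi_1,\dots,\varphi_n)$, $n\ge 0$, obtained from some $\psi\in\Psi$ by capture-avoiding substitution of formulas $\varphi_1,\dots,\varphi_n\in\mathsf{Comp}^{i}(\Psi)$ for some of its free variables (other free variables may remain). The $\mathsf{Comp}$-height of a formula in $\mathsf{Comp}(\Psi)=\bigcup_i\mathsf{Comp}^i(\Psi)$ is the least $i$ such that the formula is in $\mathsf{Comp}^i(\Psi)$. Let $\mathsf{Formulas}(M)$ be the set of formulas whose modalities $\mathtt M$ all belong to $M$. The fragment BR is $\mathsf{Comp}\big(\mathsf{Formulas}(\{\mathtt X^c,\mathtt X^g\})\cup\mathsf{Formulas}(\{\mathtt Y^c,\mathtt Y^g\})\big)$,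 and the fragment BMA is $\mathsf{Comp}\big(\mathsf{Formulas}(\{\mathtt X^g,\mathtt Y^g\})\cup\mathsf{Formulas}(\{\mathtt X^c,\mathtt Y^c\})\big)$. **Theorem.** For every formula $\varphi$ in BMA of $\mathsf{Comp}$-height $k$ there is a formula $\varphi'$ in BR of $\mathsf{Comp}$-height $k+1$, all of whose free variables are free in $\varphi$, that is equivalent to $\varphi$ over data words and data $\omega$-words. -/

import Mathlib

namespace DataMu

/-! ### Formulas of the mu-calculus on data words -/

/-- The unary modalities: global successor, class successor, global predecessor,
class predecessor. -/
inductive Modality where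
  | Xg
  | Xc
  | Yg
  | Yc

/-- The atoms: propositional variables taken from `Pr`, and the zeroary modalities. -/
inductive Atom (Pr : Type*) where
  | prop (p : Pr)
  | S
  | P
  | firstC
  | firstG
  | lastC
  | lastG

/-- Formulas, with fixpoint variables represented by de Bruijn indices (so that formulas are
identified up to renaming of bound variables): `mu φ` and `nu φ` bind the variable `0` of `φ`,
and the variable `n + 1` of `φ` is the variable `n` of `mu φ` and of `nu φ`. -/
inductive Formula (Pr : Type*) where
  | var (n : ℕ)
  | atom (a : Atom Pr)
  | natom (a : Atom Pr)
  | modal (M : Modality) (φ : Formula Pr)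
  | or (φ ψ : Formula Pr)
  | and (φ ψ : Formula Pr)
  | mu (φ : Formula Pr)
  | nu (φ : Formula Pr)

variable {Pr : Type*}

/-- `φ.FreeIn n`: the variable `n` occurs free in `φ`. -/
def Formula.FreeIn : Formula Pr → ℕ → Prop
  | .var m, n => m = n
  | .atom _, _ => False
  | .natom _, _ => False
  | .modal _ φ, n => φ.FreeIn n
  | .or φ ψ, n => φ.FreeIn n ∨ ψ.FreeIn n
  | .and φ ψ, n => φ.FreeIn n ∨ ψ.FreeIn n
  | .mu φ, n => φ.FreeIn (n + 1)
  | .nu φ, n => φ.FreeIn (n + 1)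

/-- Extension of a renaming under a binder. -/
def liftRen (r : ℕ → ℕ) : ℕ → ℕ
  | 0 => 0
  | n + 1 => r n + 1

/-- Renaming of the free variables. -/
def Formula.rename : (ℕ → ℕ) → Formula Pr → Formula Pr
  | r, .var n => .var (r n)
  | _, .atom a => .atom a
  | _, .natom a => .natom a
  | r, .modal M φ => .modal M (φ.rename r)
  | r, .or φ ψ => .or (φ.rename r) (ψ.rename r)
  | r, .and φ ψ => .and (φ.rename r) (ψ.rename r)
  | r, .mu φ => .mu (φ.rename (liftRen r))
  | r, .nu φ => .nu (φ.rename (liftRen r))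

/-- Extension of a substitution under a binder. -/
def liftSubst (σ : ℕ → Formula Pr) : ℕ → Formula Pr
  | 0 => .var 0
  | n + 1 => (σ n).rename Nat.succ

/-- Simultaneous capture-avoiding substitution of `σ n` for each free variable `n`. -/
def Formula.subst : (ℕ → Formula Pr) → Formula Pr → Formula Pr
  | σ, .var n => σ n
  | _, .atom a => .atom a
  | _, .natom a => .natom a
  | σ, .modal M φ => .modal M (φ.subst σ)
  | σ, .or φ ψ => .or (φ.subst σ) (ψ.subst σ)
  | σ, .and φ ψ => .and (φ.subst σ) (ψ.subst σ)
  | σ, .mu φ => .mu (φ.subst (liftSubst σ))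
  | σ, .nu φ => .nu (φ.subst (liftSubst σ))

/-! ### Semantics

A data word of length `n` is a map `Fin n → Set Pr × 𝒟` and a data ω-word is a map
`ℕ → Set Pr × 𝒟`: each position carries the set of the propositional variables that hold there
and a data value.  (A letter `a` of an alphabet `Σ` is the label `{a}`, with `Pr = Σ`.)
Both are handled together, as maps `w : D → Set Pr × 𝒟` on an ordered set `D` of positions.
The successor relation is `⋖`, which on `Fin n` and on `ℕ` is `j = i + 1`. -/

section Semantics

variable {𝒟 D : Type*} [LinearOrder D]

/-- `j` is the class successor of `i`: the least position after `i` with the same data value. -/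
def ClassSucc (w : D → Set Pr × 𝒟) (i j : D) : Prop :=
  i < j ∧ (w j).2 = (w i).2 ∧ ∀ k, i < k → k < j → (w k).2 ≠ (w i).2

/-- Truth of an atom at a position. -/
def Atom.Holds (w : D → Set Pr × 𝒟) (i : D) : Atom Pr → Prop
  | .prop p => p ∈ (w i).1
  | .S => ∃ j, i ⋖ j ∧ ClassSucc w i j
  | .P => ∃ j, j ⋖ i ∧ ClassSucc w j i
  | .firstC => ¬ ∃ j, ClassSucc w j i
  | .firstG => ∀ j, i ≤ j
  | .lastC => ¬ ∃ j, ClassSucc w i j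
  | .lastG => ∀ j, j ≤ i

/-- The relation followed by a modality. -/
def Modality.Step (w : D → Set Pr × 𝒟) : Modality → D → D → Prop
  | .Xg, i, j => i ⋖ j
  | .Xc, i, j => ClassSucc w i j
  | .Yg, i, j => j ⋖ i
  | .Yc, i, j => ClassSucc w j i

/-- Valuation in which the variable `0` denotes `A` and the other variables are shifted. -/
def consVal (A : Set D) (ρ : ℕ → Set D) : ℕ → Set D
  | 0 => A
  | n + 1 => ρ n

/-- The set of positions of `w` at which a formula holds, under the valuation `ρ` of the
fixpoint variables. -/
def Formula.sem (w : D → Set Pr × 𝒟) : Formula Pr → (ℕ → Set D) → Set D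
  | .var n, ρ => ρ n
  | .atom a, _ => {i | a.Holds w i}
  | .natom a, _ => {i | ¬ a.Holds w i}
  | .modal M φ, ρ => {i | ∃ j, M.Step w i j ∧ j ∈ φ.sem w ρ}
  | .or φ ψ, ρ => φ.sem w ρ ∪ ψ.sem w ρ
  | .and φ ψ, ρ => φ.sem w ρ ∩ ψ.sem w ρ
  | .mu φ, ρ => ⋂₀ {A | φ.sem w (consVal A ρ) ⊆ A}
  | .nu φ, ρ => ⋃₀ {A | A ⊆ φ.sem w (consVal A ρ)}

end Semantics

/-- Two formulas are equivalent over data words with data values in `𝒟` (of every length): they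
hold at the same positions, whatever sets of positions the free variables denote. -/
def EquivOnDataWords (𝒟 : Type*) (φ φ' : Formula Pr) : Prop :=
  ∀ (n : ℕ) (w : Fin n → Set Pr × 𝒟) (ρ : ℕ → Set (Fin n)), φ.sem w ρ = φ'.sem w ρ

/-- Two formulas are equivalent over data ω-words with data values in `𝒟`. -/
def EquivOnDataOmegaWords (𝒟 : Type*) (φ φ' : Formula Pr) : Prop :=
  ∀ (w : ℕ → Set Pr × 𝒟) (ρ : ℕ → Set ℕ), φ.sem w ρ = φ'.sem w ρ

/-! ### Composition, and the fragments BR and BMA -/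

/-- All the unary modalities of the formula belong to `Ms`. -/
def Formula.UsesOnly (Ms : Set Modality) : Formula Pr → Prop
  | .var _ => True
  | .atom _ => True
  | .natom _ => True
  | .modal M φ => M ∈ Ms ∧ φ.UsesOnly Ms
  | .or φ ψ => φ.UsesOnly Ms ∧ ψ.UsesOnly Ms
  | .and φ ψ => φ.UsesOnly Ms ∧ ψ.UsesOnly Ms
  | .mu φ => φ.UsesOnly Ms
  | .nu φ => φ.UsesOnly Ms

/-- The formulas whose unary modalities all belong to `Ms`. -/
def Formulas (Pr : Type*) (Ms : Set Modality) : Set (Formula Pr) :=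
  {φ | φ.UsesOnly Ms}

/-- The levels of the composition hierarchy: level `0` is empty, and level `i + 1` consists of the
formulas `ψ(φ₁, …, φₙ)` with `ψ ∈ Ψ` and `φ₁, …, φₙ` in level `i`. Free variables of `ψ` other
than the substituted ones may remain; hence level `1` is `Ψ`. -/
def Comp (Ψ : Set (Formula Pr)) : ℕ → Set (Formula Pr)
  | 0 => ∅
  | i + 1 => {χ | ∃ ψ ∈ Ψ, ∃ σ : ℕ → Formula Pr,
      (∀ n, σ n = .var n ∨ σ n ∈ Comp Ψ i) ∧ χ = ψ.subst σ}

/-- `φ` belongs to `⋃ i, Comp Ψ i`, and the least `i` with `φ ∈ Comp Ψ i` is `k`. -/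
def HasCompHeight (Ψ : Set (Formula Pr)) (φ : Formula Pr) (k : ℕ) : Prop :=
  IsLeast {i | φ ∈ Comp Ψ i} k

/-- Generators of BR: purely future formulas and purely past formulas. -/
def brBase (Pr : Type*) : Set (Formula Pr) :=
  Formulas Pr {.Xc, .Xg} ∪ Formulas Pr {.Yc, .Yg}

/-- Generators of BMA: purely global formulas and purely class formulas. -/
def bmaBase (Pr : Type*) : Set (Formula Pr) :=
  Formulas Pr {.Xg, .Yg} ∪ Formulas Pr {.Xc, .Yc}

end DataMu

namespace DataMu

variable {Pr : Type*}

/-! Two facts carry the theorem: a generator of BMA separates into past and future, and separated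
formulas compose at the cost of a single extra level.

Separation. A generator follows one relation in both directions, either the global or the class
successor, so its truth at a position depends only on the labels along the maximal chain of that
relation through the position (`exists_isChain`, `mem_sem_iff`). Such a chain is an ω-word, padded
with dead letters when it is finite. By a Büchi-style argument (`recognizable_subset_wsem`), truth
at position `k` is determined by finitely many types of factors: the type of the prefix up to and
including `k`, and the types of the blocks into which the rest is cut. Ramsey's theorem lets all
blocks but the first of an infinite future have one common type. Hence the formula is a finite
disjunction of conjunctions "the past has type `s`" and "the future has types `t, p, p, …`". By
Kleene's theorem these types are described by regular expressions, which become one-way fixpoint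
formulas (`trans`, `exists_separation`). Fixpoint variables cannot be negated, so these formulas
only bound the labels from below; monotonicity (`wsem_mono`) makes this enough.

Composition. Let `ψ(σ)` have height `k + 1`, and suppose by induction that each argument is an
alternation of `k + 1` one-way layers whose outermost direction is opposite to `d`. Separate `ψ`.
The half of direction `d` adds one layer to the arguments; the half of the other direction merges
with their outermost layer (`subst_mem_altLevel`). So `k + 2` layers suffice, with either outermost
direction (`exists_altLevel_equiv`).

Exact height. The number of changes of direction along a branch is at most the height
(`turns_le_of_mem_comp`). A disjunct that holds nowhere and changes direction often enough
(`zigzag`) therefore forces the height to be exactly `k + 1`. -/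

/-! ### Languages of ω-words recognized by finite types of factors -/

section Recognition

variable {Λ Λ' : Type*}

/-- The state reached from `s` after reading the letters of `W` at `a, …, a + n - 1`. -/
def run {S : Type*} (step : S → Λ → S) (s : S) (W : ℕ → Λ) (a : ℕ) : ℕ → S
  | 0 => s
  | n + 1 => step (run step s W a n) (W (a + n))

theorem run_congr {S : Type*} (step : S → Λ → S) (s : S) {W W' : ℕ → Λ} {a n : ℕ}
    (h : ∀ i, a ≤ i → i < a + n → W i = W' i) : run step s W a n = run step s W' a n := by
  induction n with
  | zero => rfl
  | succ n ih =>
    simp only [run]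
    rw [ih fun i h1 h2 => h i h1 (by omega), h (a + n) (by omega) (by omega)]

theorem run_comp {S : Type*} (step : S → Λ → S) (s : S) (f : Λ' → Λ) (W : ℕ → Λ') (a n : ℕ) :
    run step s (fun i => f (W i)) a n = run (fun s x => step s (f x)) s W a n := by
  induction n with
  | zero => rfl
  | succ n ih => simp only [run, ih]

/-- `g` is an increasing sequence of cut points, starting at `0`. -/
structure IsCut (g : ℕ → ℕ) : Prop where
  strictMono : StrictMono g
  zero : g 0 = 0

/-- Membership of an ω-word in `Q` depends only on the types of its factors, for some
factorization into nonempty words, the type of a word being the state which it leads to in a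
finite automaton. -/
def Recognizable (Q : (ℕ → Λ) → Prop) : Prop :=
  ∃ (S : Type) (_ : Finite S) (step : S → Λ → S) (s₀ : S),
    ∀ (W W' : ℕ → Λ) (g g' : ℕ → ℕ), IsCut g → IsCut g' →
      (∀ k, run step s₀ W (g k) (g (k + 1) - g k) = run step s₀ W' (g' k) (g' (k + 1) - g' k)) →
      Q W → Q W'

/-- Every position after the first cut point lies in one of the factors. -/
theorem exists_block {g : ℕ → ℕ} (hg : StrictMono g) {i : ℕ} (hi : g 0 ≤ i) :
    ∃ k, g k ≤ i ∧ i < g (k + 1) := by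
  induction i, hi using Nat.le_induction with
  | base => exact ⟨0, le_rfl, hg (by omega)⟩
  | succ i _ ih =>
    obtain ⟨k, h1, h2⟩ := ih
    by_cases h : i + 1 < g (k + 1)
    · exact ⟨k, by omega, h⟩
    · have := hg (show k + 1 < k + 1 + 1 by omega)
      exact ⟨k + 1, by omega, by omega⟩

theorem block_unique {g : ℕ → ℕ} (hg : StrictMono g) {i k l : ℕ} (h1 : g k ≤ i)
    (h2 : i < g (k + 1)) (h3 : g l ≤ i) (h4 : i < g (l + 1)) : k = l := by
  have a : k < l + 1 := hg.lt_iff_lt.1 (by omega)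
  have b : l < k + 1 := hg.lt_iff_lt.1 (by omega)
  omega

/-- Sequences can be defined factor by factor. -/
theorem exists_glue {X : Type*} {g : ℕ → ℕ} (hg : StrictMono g) (u : ℕ → X) (v : ℕ → ℕ → X) :
    ∃ V : ℕ → X, (∀ i, i < g 0 → V i = u i) ∧
      ∀ k i, g k ≤ i → i < g (k + 1) → V i = v k i := by
  have : ∀ i, ∃ x, (i < g 0 → x = u i) ∧ ∀ k, g k ≤ i → i < g (k + 1) → x = v k i := by
    intro i
    by_cases hi : i < g 0
    · refine ⟨u i, fun _ => rfl, fun k h _ => ?_⟩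
      have := hg.monotone (Nat.zero_le k)
      omega
    · obtain ⟨k, h1, h2⟩ := exists_block hg (not_lt.1 hi)
      exact ⟨v k i, fun h => absurd h hi, fun l h3 h4 => by rw [block_unique hg h1 h2 h3 h4]⟩
  choose V hV using this
  exact ⟨V, fun i => (hV i).1, fun k i => (hV i).2 k⟩

/-- The definition is symmetric in the two words, so the same automaton serves for the complement.
-/
theorem Recognizable.not {Q : (ℕ → Λ) → Prop} (h : Recognizable Q) :
    Recognizable fun W => ¬ Q W := by
  obtain ⟨S, hS, step, s₀, h⟩ := h
  exact ⟨S, hS, step, s₀, fun W W' g g' hg hg' e hn hq =>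
    hn (h W' W g' g hg' hg (fun k => (e k).symm) hq)⟩

theorem Recognizable.and {Q Q' : (ℕ → Λ) → Prop} (h : Recognizable Q) (h' : Recognizable Q') :
    Recognizable fun W => Q W ∧ Q' W := by
  obtain ⟨S, hS, step, s₀, h⟩ := h
  obtain ⟨S', hS', step', s₀', h'⟩ := h'
  let st : S × S' → Λ → S × S' := fun p x => (step p.1 x, step' p.2 x)
  have key : ∀ (W : ℕ → Λ) a n, run st (s₀, s₀') W a n
        = (run step s₀ W a n, run step' s₀' W a n) := by
    intro W a n
    induction n with
    | zero => rfl
    | succ n ih => simp only [run, ih, st]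
  refine ⟨S × S', inferInstance, st, (s₀, s₀'), fun W W' g g' hg hg' e hq => ?_⟩
  simp only [key, Prod.mk.injEq] at e
  exact ⟨h W W' g g' hg hg' (fun k => (e k).1) hq.1, h' W W' g g' hg hg' (fun k => (e k).2) hq.2⟩

theorem Recognizable.comap {Q : (ℕ → Λ) → Prop} (h : Recognizable Q) (f : Λ' → Λ) :
    Recognizable fun W => Q fun k => f (W k) := by
  obtain ⟨S, hS, step, s₀, h⟩ := h
  refine ⟨S, hS, fun s x => step s (f x), s₀, fun W W' g g' hg hg' e hq => ?_⟩
  refine h _ _ g g' hg hg' (fun k => ?_) hq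
  rw [run_comp step s₀ f W, run_comp step s₀ f W', e k]

/-- Subset construction: the type of a factor is the set of types of all its labellings. When these
sets agree block by block, a labelling of one word is matched on each block of the other, and the
pieces are glued. No compatibility between blocks is needed because every block is read from `s₀`.
-/
theorem Recognizable.exists {Q : (ℕ → Λ × Prop) → Prop} (h : Recognizable Q) :
    Recognizable fun W => ∃ X : ℕ → Prop, Q fun k => (W k, X k) := by
  obtain ⟨S, hS, step, s₀, h⟩ := h
  let st : Set S → Λ → Set S := fun A x => {t | ∃ s ∈ A, ∃ b : Prop, t = step s (x, b)}
  have key : ∀ (W : ℕ → Λ) a n, run st {s₀} W a n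
        = {t | ∃ X : ℕ → Prop, t = run step s₀ (fun k => (W k, X k)) a n} := by
    intro W a n
    induction n with
    | zero => ext t; simp [run]
    | succ n ih =>
      ext t
      simp only [run, ih, st, Set.mem_ofPred_eq]
      constructor
      · rintro ⟨s, ⟨X, rfl⟩, b, rfl⟩
        refine ⟨fun i => if i < a + n then X i else b, ?_⟩
        simp only [lt_irrefl, if_false]
        congr 1
        exact run_congr _ _ fun i _ h2 => by simp [h2]
      · rintro ⟨X, rfl⟩
        exact ⟨_, ⟨X, rfl⟩, _, rfl⟩
  refine ⟨Set S, inferInstance, st, {s₀}, fun W W' g g' hg hg' e => ?_⟩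
  rintro ⟨X, hX⟩
  simp only [key] at e
  have : ∀ k, ∃ Y : ℕ → Prop, run step s₀ (fun i => (W i, X i)) (g k) (g (k + 1) - g k)
      = run step s₀ (fun i => (W' i, Y i)) (g' k) (g' (k + 1) - g' k) := by
    intro k
    have hm : run step s₀ (fun i => (W i, X i)) (g k) (g (k + 1) - g k) ∈
        {t | ∃ X : ℕ → Prop, t = run step s₀ (fun i => (W i, X i)) (g k) (g (k + 1) - g k)} :=
      ⟨X, rfl⟩
    rw [e k] at hm
    exact hm
  choose v hv using this
  obtain ⟨V, -, hV⟩ := exists_glue hg'.strictMono X v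
  refine ⟨V, h _ _ g g' hg hg' (fun k => ?_) hX⟩
  rw [hv k]
  refine run_congr _ _ fun i h1 h2 => ?_
  have := hg'.strictMono (Nat.lt_add_one k)
  rw [hV k i h1 (by omega)]

/-- The type of a factor records its first letter, its last letter and whether `P` holds at all
adjacent pairs inside. Pairs that straddle two blocks are then seen from the last letter of one and
the first letter of the next. -/
theorem Recognizable.local {H : Type} [Finite H] (h : Λ → H) (P₀ : H → Prop)
    (P : H → H → Prop) :
    Recognizable fun W : ℕ → Λ => P₀ (h (W 0)) ∧ ∀ k, P (h (W k)) (h (W (k + 1))) := by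
  classical
  let step : Option (H × H × Prop) → Λ → Option (H × H × Prop) := fun s x =>
    some (s.elim (h x, h x, True) fun p => (p.1, h x, p.2.2 ∧ P p.2.1 (h x)))
  have key : ∀ (W : ℕ → Λ) a n, run step none W a (n + 1) =
      some (h (W a), h (W (a + n)), ∀ i, a ≤ i → i < a + n → P (h (W i)) (h (W (i + 1)))) := by
    intro W a n
    induction n with
    | zero =>
      simp only [run, step, Option.elim, Option.some.injEq, Prod.mk.injEq, true_and, add_zero,
        eq_iff_iff, true_iff]
      omega
    | succ n ih =>
      rw [run, ih]
      simp only [step, Option.elim, Option.some.injEq, Prod.mk.injEq, true_and, eq_iff_iff]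
      constructor
      · rintro ⟨h1, h2⟩ i h3 h4
        rcases Nat.lt_succ_iff_lt_or_eq.1 h4 with h5 | rfl
        · exact h1 i h3 h5
        · exact h2
      · exact fun h1 => ⟨fun i h2 h3 => h1 i h2 (by omega), h1 _ (by omega) (by omega)⟩
  refine ⟨Option (H × H × Prop), inferInstance, step, none, fun W W' g g' hg hg' e hq => ?_⟩
  have e' : ∀ k, h (W (g k)) = h (W' (g' k)) ∧
      h (W (g (k + 1) - 1)) = h (W' (g' (k + 1) - 1)) ∧
      ((∀ i, g k ≤ i → i < g (k + 1) - 1 → P (h (W i)) (h (W (i + 1)))) ↔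
        ∀ i, g' k ≤ i → i < g' (k + 1) - 1 → P (h (W' i)) (h (W' (i + 1)))) := by
    intro k
    have h1 := hg.strictMono (Nat.lt_add_one k)
    have h2 := hg'.strictMono (Nat.lt_add_one k)
    have := e k
    -- Blocks are nonempty, so their types are never `none`.
    rw [show g (k + 1) - g k = g (k + 1) - g k - 1 + 1 by omega,
      show g' (k + 1) - g' k = g' (k + 1) - g' k - 1 + 1 by omega, key, key] at this
    simp only [Option.some.injEq, Prod.mk.injEq, eq_iff_iff] at this
    rwa [show g k + (g (k + 1) - g k - 1) = g (k + 1) - 1 by omega,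
      show g' k + (g' (k + 1) - g' k - 1) = g' (k + 1) - 1 by omega] at this
  refine ⟨?_, fun i => ?_⟩
  · have := (e' 0).1
    rw [hg.zero, hg'.zero] at this
    exact this ▸ hq.1
  · obtain ⟨k, h1, h2⟩ := exists_block hg'.strictMono (i := i) (by rw [hg'.zero]; omega)
    obtain ⟨a, b, c⟩ := e' k
    by_cases hi : i + 1 < g' (k + 1)
    · exact c.1 (fun j _ _ => hq.2 j) i h1 (by omega)
    · have h3 : i + 1 = g' (k + 1) := by omega
      have h4 := hq.2 (g (k + 1) - 1)
      have h5 := hg.strictMono (Nat.lt_add_one k)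
      rw [show g (k + 1) - 1 + 1 = g (k + 1) by omega, b, (e' (k + 1)).1, ← h3] at h4
      simpa using h4

theorem Recognizable.forall_letter (p : Λ → Prop) :
    Recognizable fun W : ℕ → Λ => ∀ k, p (W k) := by
  have := Recognizable.local p (fun _ => True) (fun a _ => a)
  simpa using this

theorem Recognizable.congr {Q Q' : (ℕ → Λ) → Prop} (h : Recognizable Q)
    (e : ∀ W, Q W ↔ Q' W) : Recognizable Q' := by
  rwa [← show Q = Q' from funext fun W => propext (e W)]

end Recognition

/-! ### Semantics over labelled ω-words -/

/-- A label: the atoms and the fixpoint variables that hold at a position, and whether the position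
exists.  A finite word is represented by an ω-word in which only an initial segment exists. -/
@[ext]
structure Letter (Pr : Type*) where
  atoms : Atom Pr → Prop
  vars : ℕ → Prop
  alive : Prop

/-- The label of positions that do not exist. -/
def deadLetter (Pr : Type*) : Letter Pr := ⟨fun _ => False, fun _ => False, False⟩

/-- The variable `0` is given the truth value `b`, and the other variables are shifted. -/
def Letter.cons (b : Prop) (l : Letter Pr) : Letter Pr :=
  { l with vars := fun n => match n with
                            | 0 => b
                            | n + 1 => l.vars n }

/-- The relabelling in which the variable `0` denotes `A`. -/
def consWord (A : Set ℕ) (W : ℕ → Letter Pr) : ℕ → Letter Pr := fun k => (W k).cons (k ∈ A)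

/-- The modalities that move forward. -/
def Modality.Fwd : Modality → Prop
  | .Xg => True
  | .Xc => True
  | .Yg => False
  | .Yc => False

/-- The relation followed by a modality in an ω-word. -/
def Modality.Move (W : ℕ → Letter Pr) (M : Modality) (k l : ℕ) : Prop :=
  (M.Fwd ∧ l = k + 1 ∧ (W l).alive) ∨ (¬ M.Fwd ∧ k = l + 1)

/-- The set of positions of an ω-word at which a formula holds. -/
def Formula.wsem : Formula Pr → (ℕ → Letter Pr) → Set ℕ
  | .var n, W => {k | (W k).vars n}
  | .atom a, W => {k | (W k).atoms a}
  | .natom a, W => {k | ¬ (W k).atoms a}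
  | .modal M φ, W => {k | ∃ l, M.Move W k l ∧ l ∈ φ.wsem W}
  | .or φ ψ, W => φ.wsem W ∪ ψ.wsem W
  | .and φ ψ, W => φ.wsem W ∩ ψ.wsem W
  | .mu φ, W => {k | ∀ A, φ.wsem (consWord A W) ⊆ A → k ∈ A}
  | .nu φ, W => {k | ∃ A, A ⊆ φ.wsem (consWord A W) ∧ k ∈ A}

/-- The atom `a` occurs in the formula. -/
def Formula.HasAtom (a : Atom Pr) : Formula Pr → Prop
  | .var _ => False
  | .atom b => a = b
  | .natom b => a = b
  | .modal _ φ => φ.HasAtom a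
  | .or φ ψ => φ.HasAtom a ∨ ψ.HasAtom a
  | .and φ ψ => φ.HasAtom a ∨ ψ.HasAtom a
  | .mu φ => φ.HasAtom a
  | .nu φ => φ.HasAtom a

theorem finite_hasAtom (φ : Formula Pr) : {a | φ.HasAtom a}.Finite := by
  induction φ with
  | var n => simp [Formula.HasAtom]
  | atom a => simp [Formula.HasAtom]
  | natom a => simp [Formula.HasAtom]
  | modal M φ ih => simpa [Formula.HasAtom] using ih
  | or φ ψ ih ih' => exact (ih.union ih').subset fun a h => h
  | and φ ψ ih ih' => exact (ih.union ih').subset fun a h => h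
  | mu φ ih => simpa [Formula.HasAtom] using ih
  | nu φ ih => simpa [Formula.HasAtom] using ih

theorem finite_freeIn (φ : Formula Pr) : {n | φ.FreeIn n}.Finite := by
  induction φ with
  | var n => simp [Formula.FreeIn]
  | atom a => simp [Formula.FreeIn]
  | natom a => simp [Formula.FreeIn]
  | modal M φ ih => simpa [Formula.FreeIn] using ih
  | or φ ψ ih ih' => exact (ih.union ih').subset fun a h => h
  | and φ ψ ih ih' => exact (ih.union ih').subset fun a h => h
  | mu φ ih => exact ih.preimage (Nat.succ_injective.injOn)
  | nu φ ih => exact ih.preimage (Nat.succ_injective.injOn)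

/-- The free variables occur only positively. -/
theorem wsem_mono (φ : Formula Pr) {W W' : ℕ → Letter Pr}
    (ha : ∀ k a, φ.HasAtom a → ((W k).atoms a ↔ (W' k).atoms a))
    (hv : ∀ k n, φ.FreeIn n → (W k).vars n → (W' k).vars n)
    (hl : ∀ k, (W k).alive ↔ (W' k).alive) : φ.wsem W ⊆ φ.wsem W' := by
  induction φ generalizing W W' with
  | var n => exact fun k => hv k n rfl
  | atom a => exact fun k => (ha k a rfl).1
  | natom a => exact fun k => mt (ha k a rfl).2
  | modal M φ ih =>
    rintro k ⟨l, h, h'⟩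
    refine ⟨l, ?_, ih ha hv hl h'⟩
    simpa only [Modality.Move, hl] using h
  | or φ ψ ih ih' =>
    exact Set.union_subset_union
      (ih (fun k a h => ha k a (.inl h)) (fun k n h => hv k n (.inl h)) hl)
      (ih' (fun k a h => ha k a (.inr h)) (fun k n h => hv k n (.inr h)) hl)
  | and φ ψ ih ih' =>
    exact Set.inter_subset_inter
      (ih (fun k a h => ha k a (.inl h)) (fun k n h => hv k n (.inl h)) hl)
      (ih' (fun k a h => ha k a (.inr h)) (fun k n h => hv k n (.inr h)) hl)
  | mu φ ih =>
    intro k h A hA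
    refine h A (subset_trans (ih (W' := consWord A W') (fun k a h => ha k a h) (fun k n h => ?_) hl) hA)
    cases n with
    | zero => exact id
    | succ n => exact hv k n h
  | nu φ ih =>
    rintro k ⟨A, hA, hk⟩
    refine ⟨A, subset_trans hA (ih (fun k a h => ha k a h) (fun k n h => ?_) hl), hk⟩
    cases n with
    | zero => exact id
    | succ n => exact hv k n h

theorem wsem_rename (φ : Formula Pr) (r : ℕ → ℕ) (W : ℕ → Letter Pr) :
    (φ.rename r).wsem W = φ.wsem fun k => { W k with vars := fun n => (W k).vars (r n) } := by
  have key : ∀ (A : Set ℕ) (r : ℕ → ℕ) (W : ℕ → Letter Pr),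
      (fun k => { consWord A W k with vars := fun n => (consWord A W k).vars (liftRen r n) })
        = consWord A fun k => { W k with vars := fun n => (W k).vars (r n) } := by
    intro A r W
    funext k
    ext n
    · rfl
    · cases n <;> rfl
    · rfl
  induction φ generalizing r W with
  | var n => rfl
  | atom a => rfl
  | natom a => rfl
  | modal M φ ih => simp only [Formula.rename, Formula.wsem, ih]; rfl
  | or φ ψ ih ih' => simp only [Formula.rename, Formula.wsem, ih, ih']
  | and φ ψ ih ih' => simp only [Formula.rename, Formula.wsem, ih, ih']
  | mu φ ih => simp only [Formula.rename, Formula.wsem, ih, key]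
  | nu φ ih => simp only [Formula.rename, Formula.wsem, ih, key]

theorem wsem_rename_succ (φ : Formula Pr) (A : Set ℕ) (W : ℕ → Letter Pr) :
    (φ.rename Nat.succ).wsem (consWord A W) = φ.wsem W := by
  rw [wsem_rename]
  rfl

/-- The sets contained in the denotation of a formula form a recognizable language. -/
theorem recognizable_subset_wsem (φ : Formula Pr) :
    Recognizable fun U : ℕ → Letter Pr × Prop =>
      ∀ k, (U k).2 → k ∈ φ.wsem fun k => (U k).1 := by
  -- Speaking of a marked set below the denotation, rather than of one position, lets every
  -- constructor be expressed by projection, Boolean operations and local conditions: a projected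
  -- set `Y` stands for a set below the denotation of the immediate subformula.
  induction φ with
  | var n => exact Recognizable.forall_letter fun u : Letter Pr × Prop => u.2 → u.1.vars n
  | atom a => exact Recognizable.forall_letter fun u : Letter Pr × Prop => u.2 → u.1.atoms a
  | natom a => exact Recognizable.forall_letter fun u : Letter Pr × Prop => u.2 → ¬ u.1.atoms a
  | modal M φ ih =>
    have ih' := ih.comap fun u : (Letter Pr × Prop) × Prop => (u.1.1, u.2)
    by_cases hM : M.Fwd
    · have := (ih'.and (Recognizable.local
        (fun u : (Letter Pr × Prop) × Prop => (u.1.2, u.1.1.alive ∧ u.2))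
        (fun _ => True) (fun a b => a.1 → b.2))).exists
      refine this.congr fun U => ⟨?_, fun h => ?_⟩
      · rintro ⟨Y, h1, -, h2⟩ k hk
        obtain ⟨h3, h4⟩ := h2 k hk
        exact ⟨k + 1, .inl ⟨hM, rfl, h3⟩, h1 _ h4⟩
      · refine ⟨fun k => k ∈ φ.wsem fun k => (U k).1, fun k => id, trivial, fun k hk => ?_⟩
        obtain ⟨l, ⟨-, rfl, h2⟩ | ⟨h1, -⟩, h3⟩ := h k hk
        · exact ⟨h2, h3⟩
        · exact absurd hM h1
    · have := (ih'.and (Recognizable.local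
        (fun u : (Letter Pr × Prop) × Prop => (u.1.2, u.2))
        (fun a => ¬ a.1) (fun a b => b.1 → a.2))).exists
      refine this.congr fun U => ⟨?_, fun h => ?_⟩
      · rintro ⟨Y, h1, h2, h3⟩ k hk
        cases k with
        | zero => exact absurd hk h2
        | succ k => exact ⟨k, .inr ⟨hM, rfl⟩, h1 _ (h3 k hk)⟩
      · refine ⟨fun k => k ∈ φ.wsem fun k => (U k).1, fun k => id, fun h0 => ?_, fun k hk => ?_⟩
        · obtain ⟨l, ⟨h1, -⟩ | ⟨-, h1⟩, -⟩ := h 0 h0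
          · exact absurd h1 hM
          · omega
        · obtain ⟨l, ⟨h1, -⟩ | ⟨-, h1⟩, h3⟩ := h _ hk
          · exact absurd h1 hM
          · obtain rfl : k = l := by omega
            exact h3
  | or φ ψ ih ih' =>
    have := ((ih.comap fun u : (Letter Pr × Prop) × Prop => (u.1.1, u.1.2 ∧ u.2)).and
      (ih'.comap fun u : (Letter Pr × Prop) × Prop => (u.1.1, u.1.2 ∧ ¬ u.2))).exists
    refine this.congr fun U => ⟨?_, fun h => ?_⟩
    · rintro ⟨Y, h1, h2⟩ k hk
      by_cases hY : Y k
      · exact .inl (h1 k ⟨hk, hY⟩)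
      · exact .inr (h2 k ⟨hk, hY⟩)
    · refine ⟨fun k => k ∈ φ.wsem fun k => (U k).1, fun k hk => hk.2, fun k hk => ?_⟩
      exact (h k hk.1).resolve_left hk.2
  | and φ ψ ih ih' =>
    exact (ih.and ih').congr fun U =>
      ⟨fun h k hk => ⟨h.1 k hk, h.2 k hk⟩, fun h => ⟨fun k hk => (h k hk).1, fun k hk => (h k hk).2⟩⟩
  | mu φ ih =>
    -- The induction hypothesis only describes sets below a denotation, so `φ(A) ⊆ A` is phrased as:
    -- no `Y ⊆ φ(A)` fails to lie in `A`. The marked set is below the least fixpoint when no such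
    -- `A` fails to contain it.
    have h1 := ((ih.comap fun u : ((Letter Pr × Prop) × Prop) × Prop =>
      (u.1.1.1.cons u.1.2, u.2)).and
      (Recognizable.forall_letter fun u : ((Letter Pr × Prop) × Prop) × Prop =>
        u.2 → u.1.2).not).exists.not
    have h2 := (h1.and (Recognizable.forall_letter fun u : (Letter Pr × Prop) × Prop =>
      u.1.2 → u.2).not).exists.not
    refine h2.congr fun U => ?_
    have e : ∀ A : ℕ → Prop, (¬ ∃ Y : ℕ → Prop,
        (∀ k, Y k → k ∈ φ.wsem fun k => (U k).1.cons (A k)) ∧ ¬ ∀ k, Y k → A k) ↔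
        φ.wsem (consWord {k | A k} fun k => (U k).1) ⊆ {k | A k} := by
      intro A
      constructor
      · intro h
        by_contra hn
        exact h ⟨fun k => k ∈ φ.wsem (consWord {k | A k} fun k => (U k).1), fun k hk => hk, hn⟩
      · rintro h ⟨Y, h3, h4⟩
        exact h4 fun k hk => h (h3 k hk)
    constructor
    · intro h k hk A hA
      by_contra hn
      exact h ⟨fun k => k ∈ A, (e _).2 hA, fun h => hn (h k hk)⟩
    · rintro h ⟨A, hA, hn⟩
      exact hn fun k hk => h k hk {k | A k} ((e A).1 hA)
  | nu φ ih =>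
    have := ((ih.comap fun u : (Letter Pr × Prop) × Prop => (u.1.1.cons u.2, u.2)).and
      (Recognizable.forall_letter fun u : (Letter Pr × Prop) × Prop => u.1.2 → u.2)).exists
    refine this.congr fun U => ⟨?_, fun h => ?_⟩
    · rintro ⟨A, h1, h2⟩ k hk
      exact ⟨{k | A k}, h1, h2 k hk⟩
    -- One set must serve all marked positions: the union of the post-fixed points, itself
    -- post-fixed by monotonicity.
    · refine ⟨fun k => ∃ A : Set ℕ, A ⊆ φ.wsem (consWord A fun k => (U k).1) ∧ k ∈ A, ?_,
        fun k hk => h k hk⟩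
      rintro k ⟨A, hA, hk⟩
      refine wsem_mono φ (W := consWord A fun k => (U k).1)
        (W' := consWord {k | ∃ A : Set ℕ, A ⊆ φ.wsem (consWord A fun k => (U k).1) ∧ k ∈ A}
          fun k => (U k).1)
        (fun _ _ _ => Iff.rfl) (fun j n _ => ?_) (fun _ => Iff.rfl) (hA hk)
      cases n with
      | zero => exact fun hj => ⟨A, hA, hj⟩
      | succ n => exact id

/-! ### Ramsey's theorem for consecutive pairs, and Kleene's theorem -/

/-- For every colouring of the pairs of natural numbers with finitely many colours there is an
increasing sequence, starting after `a`, of which the consecutive pairs have the same colour. -/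
theorem exists_strictMono_const_color {S : Type*} [Finite S] (c : ℕ → ℕ → S) (a : ℕ) :
    ∃ (e : S) (g : ℕ → ℕ), StrictMono g ∧ a < g 0 ∧ ∀ n, c (g n) (g (n + 1)) = e := by
  suffices h : ∀ T : Set S, T.Finite → ∀ f : ℕ → ℕ, StrictMono f → a < f 0 →
      (∀ m n, m < n → c (f m) (f n) ∈ T) →
      ∃ (e : S) (g : ℕ → ℕ), StrictMono g ∧ a < g 0 ∧ ∀ n, c (g n) (g (n + 1)) = e from
    h Set.univ Set.finite_univ (fun n => a + 1 + n) (fun m n h => by simpa using h) (by simp)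
      fun _ _ _ => trivial
  intro T hT
  induction T, hT using Set.Finite.induction_on with
  | empty => exact fun f _ _ h => (h 0 1 one_pos).elim
  | @insert e T _ _ ih =>
    intro f hf h0 h
    -- Either some subsequence has colour `e` at all consecutive pairs, or some subsequence avoids
    -- `e` at all pairs and the set of available colours shrinks.
    obtain ⟨g, hg | hg⟩ := exists_increasing_or_nonincreasing_subseq' (fun x y => c x y = e) f
    · exact ⟨e, f ∘ g, hf.comp g.strictMono, h0.trans_le (hf.monotone (Nat.zero_le _)), hg⟩
    · exact ih (f ∘ g) (hf.comp g.strictMono) (h0.trans_le (hf.monotone (Nat.zero_le _)))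
        fun m n hmn => (h _ _ (g.strictMono hmn)).resolve_left (hg m n hmn)

section Kleene

variable {S Λ : Type*}

/-- `u` labels a path from `p` to `q` of which the states strictly inside belong to `K`. -/
def PathIn (edge : S → Λ → S → Prop) (K : Set S) : S → List Λ → S → Prop
  | p, [], q => p = q
  | p, a :: u, q => ∃ p', edge p a p' ∧ (u = [] ∨ p' ∈ K) ∧ PathIn edge K p' u q

theorem PathIn.mono {edge : S → Λ → S → Prop} {K K' : Set S} (h : K ⊆ K') {p q : S}
    {u : List Λ} (hu : PathIn edge K p u q) : PathIn edge K' p u q := by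
  induction u generalizing p with
  | nil => exact hu
  | cons a u ih =>
    obtain ⟨p', h1, h2, h3⟩ := hu
    exact ⟨p', h1, h2.imp_right fun h' => h h', ih h3⟩

theorem PathIn.append {edge : S → Λ → S → Prop} {K : Set S} {p k q : S} (hk : k ∈ K)
    {u v : List Λ} (hu : PathIn edge K p u k) (hv : PathIn edge K k v q) :
    PathIn edge K p (u ++ v) q := by
  induction u generalizing p with
  | nil => obtain rfl : p = k := hu; exact hv
  | cons a u ih =>
    obtain ⟨p', h1, h2, h3⟩ := hu
    refine ⟨p', h1, .inr ?_, ih h3⟩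
    rcases h2 with rfl | h2
    · obtain rfl : p' = k := h3
      exact hk
    · exact h2

/-- Cut the path at its visits to `k`: a first part reaching `k`, a list of loops at `k`, a last
part leaving `k`, each with its interior in `K`. This is the recursion step of Kleene's theorem. -/
theorem pathIn_insert {edge : S → Λ → S → Prop} {K : Set S} {p k q : S} {u : List Λ} :
    PathIn edge (insert k K) p u q ↔ PathIn edge K p u q ∨
      ∃ x y z, u = x ++ (y ++ z) ∧ PathIn edge K p x k ∧
        (∃ L : List (List Λ), y = L.flatten ∧ ∀ v ∈ L, PathIn edge K k v k) ∧
        PathIn edge K k z q := by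
  constructor
  · intro h
    induction u generalizing p with
    | nil => exact .inl h
    | cons a u ih =>
      obtain ⟨p', h1, h2, h3⟩ := h
      by_cases hu : u = []
      · subst hu
        exact .inl ⟨p', h1, .inl rfl, h3⟩
      rcases h2.resolve_left hu with rfl | hK
      · right
        rcases ih h3 with h4 | ⟨x, y, z, rfl, h4, ⟨L, rfl, hL⟩, h5⟩
        · exact ⟨[a], [], u, rfl, ⟨p', h1, .inl rfl, rfl⟩, ⟨[], rfl, by simp⟩, h4⟩
        · exact ⟨[a], x ++ L.flatten, z, by simp, ⟨p', h1, .inl rfl, rfl⟩,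
            ⟨x :: L, rfl, by simpa using ⟨h4, hL⟩⟩, h5⟩
      · rcases ih h3 with h4 | ⟨x, y, z, rfl, h4, h5⟩
        · exact .inl ⟨p', h1, .inr hK, h4⟩
        · exact .inr ⟨a :: x, y, z, rfl, ⟨p', h1, .inr hK, h4⟩, h5⟩
  · rintro (h | ⟨x, y, z, rfl, h1, ⟨L, rfl, hL⟩, h2⟩)
    · exact h.mono (Set.subset_insert k K)
    · have hk := Set.mem_insert k K
      refine (h1.mono (Set.subset_insert k K)).append hk (PathIn.append (k := k) hk ?_
        (h2.mono (Set.subset_insert k K)))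
      clear h2
      induction L with
      | nil => rfl
      | cons v L ih =>
        exact ((hL v (by simp)).mono (Set.subset_insert k K)).append hk
          (ih fun w hw => hL w (by simp [hw]))

theorem exists_regex_biUnion {ι : Type*} {T : Set ι} (hT : T.Finite)
    (r : ι → RegularExpression Λ) :
    ∃ R : RegularExpression Λ, ∀ u, u ∈ R.matches' ↔ ∃ i ∈ T, u ∈ (r i).matches' := by
  induction T, hT using Set.Finite.induction_on with
  | empty => exact ⟨0, fun u => by simp⟩
  | @insert i T _ _ ih =>
    obtain ⟨R, hR⟩ := ih
    refine ⟨r i + R, fun u => ?_⟩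
    rw [RegularExpression.matches'_add, Language.mem_add, hR]
    simp

/-- **Kleene's theorem**: the labels of the paths between two vertices of a finite labelled graph
form the language of a regular expression. -/
theorem exists_regex_path [Finite S] [Finite Λ] (edge : S → Λ → S → Prop) (K : Set S) (p q : S) :
    ∃ r : RegularExpression Λ, ∀ u, u ∈ r.matches' ↔ PathIn edge K p u q := by
  classical
  induction K, K.toFinite using Set.Finite.induction_on generalizing p q with
  | empty =>
    obtain ⟨R, hR⟩ := exists_regex_biUnion (Set.toFinite {a : Λ | edge p a q})
      RegularExpression.char
    refine ⟨(if p = q then 1 else 0) + R, fun u => ?_⟩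
    rw [RegularExpression.matches'_add, Language.mem_add, hR]
    have : u ∈ (if p = q then 1 else 0 : RegularExpression Λ).matches' ↔ p = q ∧ u = [] := by
      split_ifs with h
      · simp [h, Language.mem_one]
      · simp [h]
    rw [this]
    rcases u with _ | ⟨a, u⟩
    · have e : ∀ b : Λ, [] ∉ ({[b]} : Language Λ) :=
        fun b h => List.cons_ne_nil b [] (Set.mem_singleton_iff.1 h).symm
      simp [PathIn, e]
    · have e : ∀ b : Λ, a :: u ∈ ({[b]} : Language Λ) ↔ a :: u = [b] := fun b => Iff.rfl
      simp only [Set.mem_ofPred_eq, RegularExpression.matches'_char, e, PathIn, List.cons.injEq,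
        reduceCtorEq, and_false, false_or, Set.mem_empty_iff_false, or_false]
      constructor
      · rintro ⟨b, h, rfl, rfl⟩
        exact ⟨q, h, rfl, rfl⟩
      · rintro ⟨p', h, rfl, rfl⟩
        exact ⟨a, h, rfl, rfl⟩
  | @insert k K _ _ ih =>
    obtain ⟨r₁, h₁⟩ := ih p q
    obtain ⟨r₂, h₂⟩ := ih p k
    obtain ⟨r₃, h₃⟩ := ih k k
    obtain ⟨r₄, h₄⟩ := ih k q
    refine ⟨r₁ + r₂ * (r₃.star * r₄), fun u => ?_⟩
    rw [pathIn_insert, RegularExpression.matches'_add, Language.mem_add, h₁]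
    simp only [RegularExpression.matches'_mul, RegularExpression.matches'_star, Language.mem_mul,
      Language.mem_kstar, h₂, h₃, h₄]
    refine or_congr Iff.rfl ⟨?_, ?_⟩
    · rintro ⟨x, hx, _, ⟨y, hy, z, hz, rfl⟩, rfl⟩
      exact ⟨x, y, z, rfl, hx, hy, hz⟩
    · rintro ⟨x, y, z, rfl, hx, hy, hz⟩
      exact ⟨x, hx, _, ⟨y, hy, z, hz, rfl⟩, rfl⟩

theorem exists_regex_foldl [Finite S] [Finite Λ] (step : S → Λ → S) (p q : S) :
    ∃ r : RegularExpression Λ, ∀ u, u ∈ r.matches' ↔ u.foldl step p = q := by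
  obtain ⟨r, hr⟩ := exists_regex_path (fun p a q => step p a = q) Set.univ p q
  refine ⟨r, fun u => (hr u).trans ?_⟩
  clear hr
  induction u generalizing p with
  | nil => rfl
  | cons a u ih => simp [PathIn, ih]

/-- A right fold consumes the word from its end, so the automaton is run on reversed edges, from `q`
to `p`. This serves past formulas, which meet the letters in reverse order. -/
theorem exists_regex_foldr [Finite S] [Finite Λ] (step : S → Λ → S) (p q : S) :
    ∃ r : RegularExpression Λ, ∀ u, u ∈ r.matches' ↔ u.foldr (fun a s => step s a) p = q := by
  obtain ⟨r, hr⟩ := exists_regex_path (fun p a q => step q a = p) Set.univ q p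
  refine ⟨r, fun u => (hr u).trans ?_⟩
  clear hr
  induction u generalizing q with
  | nil => exact eq_comm
  | cons a u ih => simp [PathIn, ih]

end Kleene

/-! ### Formulas for regular expressions -/

/-- A formula that holds nowhere. -/
def falsum : Formula Pr := .mu (.var 0)

/-- A formula that holds everywhere. -/
def verum : Formula Pr := .nu (.var 0)

@[simp] theorem wsem_falsum (W : ℕ → Letter Pr) : (falsum : Formula Pr).wsem W = ∅ := by
  ext k
  simp only [falsum, Formula.wsem, Set.mem_empty_iff_false, iff_false]
  exact fun h => h ∅ fun j hj => hj

@[simp] theorem wsem_verum (W : ℕ → Letter Pr) : (verum : Formula Pr).wsem W = Set.univ := by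
  ext k
  simp only [verum, Formula.wsem, Set.mem_univ, iff_true]
  exact ⟨Set.univ, fun j hj => hj, trivial⟩

/-- The disjunction of a list of formulas. -/
def bigOr (l : List (Formula Pr)) : Formula Pr := l.foldr .or falsum

/-- The conjunction of a list of formulas. -/
def bigAnd (l : List (Formula Pr)) : Formula Pr := l.foldr .and verum

theorem mem_wsem_bigOr {l : List (Formula Pr)} {W : ℕ → Letter Pr} {k : ℕ} :
    k ∈ (bigOr l).wsem W ↔ ∃ φ ∈ l, k ∈ φ.wsem W := by
  induction l with
  | nil => simp [bigOr]
  | cons φ l ih =>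
    rw [bigOr, List.foldr_cons, ← bigOr]
    simp [Formula.wsem, ih]

theorem mem_wsem_bigAnd {l : List (Formula Pr)} {W : ℕ → Letter Pr} {k : ℕ} :
    k ∈ (bigAnd l).wsem W ↔ ∀ φ ∈ l, k ∈ φ.wsem W := by
  induction l with
  | nil => simp [bigAnd]
  | cons φ l ih =>
    rw [bigAnd, List.foldr_cons, ← bigAnd]
    simp [Formula.wsem, ih]

/-- The formula belongs to `Formulas Pr Ms`, and its free variables to `B`. -/
def Within (Ms : Set Modality) (B : Set ℕ) (φ : Formula Pr) : Prop :=
  φ.UsesOnly Ms ∧ ∀ n, φ.FreeIn n → n ∈ B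

section Within

variable {Ms : Set Modality} {B : Set ℕ}

theorem within_falsum : Within Ms B (falsum : Formula Pr) :=
  ⟨trivial, fun n h => by simp [falsum, Formula.FreeIn] at h⟩

theorem within_verum : Within Ms B (verum : Formula Pr) :=
  ⟨trivial, fun n h => by simp [verum, Formula.FreeIn] at h⟩

theorem within_atom (a : Atom Pr) : Within Ms B (.atom a) := ⟨trivial, fun _ h => h.elim⟩

theorem within_natom (a : Atom Pr) : Within Ms B (.natom a) := ⟨trivial, fun _ h => h.elim⟩

theorem within_var {n : ℕ} (h : n ∈ B) : Within Ms B (.var n : Formula Pr) :=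
  ⟨trivial, fun _ h' => h' ▸ h⟩

theorem Within.or {φ ψ : Formula Pr} (h : Within Ms B φ) (h' : Within Ms B ψ) :
    Within Ms B (φ.or ψ) := ⟨⟨h.1, h'.1⟩, fun n hn => hn.elim (h.2 n) (h'.2 n)⟩

theorem Within.and {φ ψ : Formula Pr} (h : Within Ms B φ) (h' : Within Ms B ψ) :
    Within Ms B (φ.and ψ) := ⟨⟨h.1, h'.1⟩, fun n hn => hn.elim (h.2 n) (h'.2 n)⟩

theorem Within.modal {M : Modality} {φ : Formula Pr} (hM : M ∈ Ms) (h : Within Ms B φ) :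
    Within Ms B (φ.modal M) := ⟨⟨hM, h.1⟩, h.2⟩

theorem Within.bigOr {l : List (Formula Pr)} (h : ∀ φ ∈ l, Within Ms B φ) :
    Within Ms B (bigOr l) := by
  induction l with
  | nil => exact within_falsum
  | cons φ l ih => exact (h φ (by simp)).or (ih fun ψ hψ => h ψ (by simp [hψ]))

theorem Within.bigAnd {l : List (Formula Pr)} (h : ∀ φ ∈ l, Within Ms B φ) :
    Within Ms B (bigAnd l) := by
  induction l with
  | nil => exact within_verum
  | cons φ l ih => exact (h φ (by simp)).and (ih fun ψ hψ => h ψ (by simp [hψ]))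

theorem usesOnly_rename {φ : Formula Pr} {r : ℕ → ℕ} :
    (φ.rename r).UsesOnly Ms ↔ φ.UsesOnly Ms := by
  induction φ generalizing r <;> simp_all [Formula.rename, Formula.UsesOnly]

theorem freeIn_rename {φ : Formula Pr} {r : ℕ → ℕ} {n : ℕ} :
    (φ.rename r).FreeIn n ↔ ∃ m, φ.FreeIn m ∧ r m = n := by
  have key : ∀ (P : ℕ → Prop) (r : ℕ → ℕ) n,
      (∃ m, P m ∧ liftRen r m = n + 1) ↔ ∃ m, P (m + 1) ∧ r m = n := by
    intro P r n
    constructor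
    · rintro ⟨_ | m, h, h'⟩
      · simp [liftRen] at h'
      · exact ⟨m, h, by simpa [liftRen] using h'⟩
    · rintro ⟨m, h, rfl⟩
      exact ⟨m + 1, h, rfl⟩
  induction φ generalizing r n with
  | var m => simp [Formula.rename, Formula.FreeIn]
  | atom a => simp [Formula.rename, Formula.FreeIn]
  | natom a => simp [Formula.rename, Formula.FreeIn]
  | modal M φ ih => simp only [Formula.rename, Formula.FreeIn, ih]
  | or φ ψ ih ih' => simp only [Formula.rename, Formula.FreeIn, ih, ih', or_and_right, exists_or]
  | and φ ψ ih ih' => simp only [Formula.rename, Formula.FreeIn, ih, ih', or_and_right, exists_or]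
  | mu φ ih => simp only [Formula.rename, Formula.FreeIn, ih, key]
  | nu φ ih => simp only [Formula.rename, Formula.FreeIn, ih, key]

theorem Within.rename_succ {φ : Formula Pr} (h : Within Ms B φ) :
    Within Ms {n | ∀ m, n = m + 1 → m ∈ B} (φ.rename Nat.succ) := by
  refine ⟨usesOnly_rename.2 h.1, fun n hn m hm => ?_⟩
  obtain ⟨l, h1, h2⟩ := freeIn_rename.1 hn
  obtain rfl : l = m := by omega
  exact h.2 _ h1

theorem Within.mu {φ : Formula Pr} (h : Within Ms {n | ∀ m, n = m + 1 → m ∈ B} φ) :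
    Within Ms B φ.mu := ⟨h.1, fun _ hn => h.2 _ hn _ rfl⟩

theorem Within.nu {φ : Formula Pr} (h : Within Ms {n | ∀ m, n = m + 1 → m ∈ B} φ) :
    Within Ms B φ.nu := ⟨h.1, fun _ hn => h.2 _ hn _ rfl⟩

end Within

section Trans

variable {Λ : Type*}

/-- The formula saying that from the current position a path, following the modality `M` and
labelled in the language of a regular expression, leads to a position where `z` holds. -/
def trans (M : Modality) : (Λ → Formula Pr) → RegularExpression Λ → Formula Pr → Formula Pr
  | _, .zero, _ => falsum
  | _, .epsilon, z => z
  | ℓ, .char a, z => (ℓ a).and (z.modal M)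
  | ℓ, .plus r s, z => (trans M ℓ r z).or (trans M ℓ s z)
  | ℓ, .comp r s, z => trans M ℓ r (trans M ℓ s z)
  | ℓ, .star r, z =>
      .mu ((z.rename Nat.succ).or (trans M (fun a => (ℓ a).rename Nat.succ) r (.var 0)))

theorem Within.trans {Ms : Set Modality} {B : Set ℕ} {M : Modality} (hM : M ∈ Ms)
    {ℓ : Λ → Formula Pr} (hℓ : ∀ a, Within Ms B (ℓ a)) (r : RegularExpression Λ)
    {z : Formula Pr} (hz : Within Ms B z) : Within Ms B (trans M ℓ r z) := by
  induction r generalizing ℓ z B with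
  | zero => exact within_falsum
  | epsilon => exact hz
  | char a => exact (hℓ a).and (hz.modal hM)
  | plus r s ih ih' => exact (ih hℓ hz).or (ih' hℓ hz)
  | comp r s ih ih' => exact ih hℓ (ih' hℓ hz)
  | star r ih =>
    exact (hz.rename_succ.or (ih (fun a => (hℓ a).rename_succ)
      (within_var fun m hm => by omega))).mu

/-- The word `u` is read along a path of the relation `E`, where `L a` is the set of positions
at which the letter `a` can be read. -/
def ReadPath (E : ℕ → ℕ → Prop) (L : Λ → Set ℕ) : ℕ → List Λ → ℕ → Prop
  | k, [], j => k = j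
  | k, a :: u, j => k ∈ L a ∧ ∃ l, E k l ∧ ReadPath E L l u j

theorem readPath_append {E : ℕ → ℕ → Prop} {L : Λ → Set ℕ} {k j : ℕ} {u v : List Λ} :
    ReadPath E L k (u ++ v) j ↔ ∃ l, ReadPath E L k u l ∧ ReadPath E L l v j := by
  induction u generalizing k with
  | nil => simp [ReadPath]
  | cons a u ih =>
    simp only [List.cons_append, ReadPath, ih]
    constructor
    · rintro ⟨h1, l, h2, m, h3, h4⟩
      exact ⟨m, ⟨h1, l, h2, h3⟩, h4⟩
    · rintro ⟨m, ⟨h1, l, h2, h3⟩, h4⟩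
      exact ⟨h1, l, h2, m, h3, h4⟩

/-- A letter is tested before each move, so the letter at the endpoint `j` is left to `z`. -/
theorem mem_wsem_trans {M : Modality} {ℓ : Λ → Formula Pr} {r : RegularExpression Λ}
    {z : Formula Pr} {W : ℕ → Letter Pr} {k : ℕ} :
    k ∈ (trans M ℓ r z).wsem W ↔ ∃ u ∈ r.matches', ∃ j,
      ReadPath (M.Move W) (fun a => (ℓ a).wsem W) k u j ∧ j ∈ z.wsem W := by
  induction r generalizing ℓ z W k with
  | zero =>
    simp only [trans, wsem_falsum, Set.mem_empty_iff_false, false_iff]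
    rintro ⟨u, hu, -⟩
    exact Language.notMem_zero u hu
  | epsilon =>
    rw [trans, RegularExpression.one_def, RegularExpression.matches'_epsilon]
    simp [Language.mem_one, ReadPath]
  | char a =>
    rw [trans, RegularExpression.matches'_char]
    constructor
    · rintro ⟨h, l, h1, h2⟩
      exact ⟨[a], rfl, l, ⟨h, l, h1, rfl⟩, h2⟩
    · rintro ⟨u, hu, j, h, hj⟩
      obtain rfl : u = [a] := hu
      obtain ⟨h1, l, h2, rfl⟩ := h
      exact ⟨h1, l, h2, hj⟩
  | plus r s ih ih' =>
    rw [trans, RegularExpression.plus_def, RegularExpression.matches'_add]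
    simp only [Formula.wsem, Set.mem_union, ih, ih', Language.mem_add, or_and_right, exists_or]
  | comp r s ih ih' =>
    rw [trans, RegularExpression.comp_def, RegularExpression.matches'_mul, ih]
    simp only [ih', Language.mem_mul]
    constructor
    · rintro ⟨u, hu, l, h1, v, hv, j, h2, h3⟩
      exact ⟨u ++ v, ⟨u, hu, v, hv, rfl⟩, j, readPath_append.2 ⟨l, h1, h2⟩, h3⟩
    · rintro ⟨_, ⟨u, hu, v, hv, rfl⟩, j, h, h3⟩
      obtain ⟨l, h1, h2⟩ := readPath_append.1 h
      exact ⟨u, hu, l, h1, v, hv, j, h2, h3⟩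
  | star r ih =>
    rw [trans, RegularExpression.matches'_star]
    have e : ∀ A k, k ∈ ((z.rename Nat.succ).or
        (trans M (fun a => (ℓ a).rename Nat.succ) r (.var 0))).wsem (consWord A W) ↔
        k ∈ z.wsem W ∨ ∃ u ∈ r.matches', ∃ j,
          ReadPath (M.Move W) (fun a => (ℓ a).wsem W) k u j ∧ j ∈ A := by
      intro A k
      simp only [Formula.wsem, Set.mem_union, wsem_rename_succ, ih]
      rfl
    constructor
    · intro h
      -- The positions from which an iterated path reaches `z` form a pre-fixed point, hence contain
      -- the least one.
      refine h {k | ∃ u ∈ KStar.kstar r.matches', ∃ j,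
        ReadPath (M.Move W) (fun a => (ℓ a).wsem W) k u j ∧ j ∈ z.wsem W} fun i hi => ?_
      rcases (e _ _).1 hi with hi | ⟨u, hu, j, h1, v, hv, m, h2, h3⟩
      · exact ⟨[], Language.nil_mem_kstar _, i, rfl, hi⟩
      · obtain ⟨L, rfl, hL⟩ := Language.mem_kstar.1 hv
        exact ⟨u ++ L.flatten, Language.mem_kstar.2 ⟨u :: L, rfl, by simpa using ⟨hu, hL⟩⟩, m,
          readPath_append.2 ⟨j, h1, h2⟩, h3⟩
    · rintro ⟨_, hu, j, h, hj⟩ A hA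
      obtain ⟨L, rfl, hL⟩ := Language.mem_kstar.1 hu
      clear hu
      induction L generalizing k with
      | nil =>
        obtain rfl : k = j := h
        exact hA ((e A _).2 (.inl hj))
      | cons u L ihL =>
        obtain ⟨l, h1, h2⟩ := readPath_append.1 h
        exact hA ((e A _).2 (.inr ⟨u, hL u (by simp), l, h1,
          ihL (fun v hv => hL v (by simp [hv])) h2⟩))

end Trans

/-! ### Formulas for the types of factors -/

/-- The disjunction of a finite family of formulas. -/
noncomputable def orOver {ι : Type*} [Finite ι] (f : ι → Formula Pr) : Formula Pr :=
  bigOr ((@Finset.univ ι (Fintype.ofFinite ι)).toList.map f)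

/-- The conjunction of a finite family of formulas. -/
noncomputable def andOver {ι : Type*} [Finite ι] (f : ι → Formula Pr) : Formula Pr :=
  bigAnd ((@Finset.univ ι (Fintype.ofFinite ι)).toList.map f)

theorem mem_wsem_orOver {ι : Type*} [Finite ι] {f : ι → Formula Pr} {W : ℕ → Letter Pr} {k : ℕ} :
    k ∈ (orOver f).wsem W ↔ ∃ i, k ∈ (f i).wsem W := by
  simp [orOver, mem_wsem_bigOr]

theorem mem_wsem_andOver {ι : Type*} [Finite ι] {f : ι → Formula Pr} {W : ℕ → Letter Pr} {k : ℕ} :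
    k ∈ (andOver f).wsem W ↔ ∀ i, k ∈ (f i).wsem W := by
  simp [andOver, mem_wsem_bigAnd]

theorem Within.orOver {Ms : Set Modality} {B : Set ℕ} {ι : Type*} [Finite ι]
    {f : ι → Formula Pr} (h : ∀ i, Within Ms B (f i)) : Within Ms B (orOver f) :=
  .bigOr (by simpa using h)

theorem Within.andOver {Ms : Set Modality} {B : Set ℕ} {ι : Type*} [Finite ι]
    {f : ι → Formula Pr} (h : ∀ i, Within Ms B (f i)) : Within Ms B (andOver f) :=
  .bigAnd (by simpa using h)

section Types

variable {S Λ : Type*}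

theorem run_succ' (δ : S → Λ → S) (q : S) (v : ℕ → Λ) (a n : ℕ) :
    run δ q v a (n + 1) = run δ (δ q (v a)) v (a + 1) n := by
  induction n with
  | zero => rfl
  | succ n ih =>
    rw [run, ih, run]
    congr 2
    omega

theorem exists_readPath_fwd {W : ℕ → Letter Pr} {M : Modality} (hM : M.Fwd) (δ : S → Λ → S)
    (L : Λ → Set ℕ) [Nonempty Λ] {k j : ℕ} {q p : S} :
    (∃ u : List Λ, u.foldl δ q = p ∧ ReadPath (M.Move W) L k u j) ↔
      k ≤ j ∧ ∃ v : ℕ → Λ, (∀ i, k ≤ i → i < j → i ∈ L (v i) ∧ (W (i + 1)).alive) ∧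
        run δ q v k (j - k) = p := by
  constructor
  · rintro ⟨u, rfl, h⟩
    induction u generalizing k q with
    | nil =>
      obtain rfl : k = j := h
      exact ⟨le_rfl, fun _ => Classical.arbitrary Λ, fun i _ _ => by omega, by simp [run]⟩
    | cons a u ih =>
      obtain ⟨h1, l, ⟨-, rfl, h2⟩ | ⟨h2, -⟩, h3⟩ := h
      · obtain ⟨h4, v, h5, h6⟩ := ih (q := δ q a) h3
        refine ⟨by omega, fun i => if i = k then a else v i, fun i h7 h8 => ?_, ?_⟩
        · dsimp only
          split_ifs with h9
          · exact h9 ▸ ⟨h1, h2⟩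
          · exact h5 i (by omega) h8
        · rw [show j - k = j - (k + 1) + 1 by omega, run_succ', List.foldl_cons, ← h6]
          simp only [if_true]
          exact run_congr _ _ fun i h7 _ => if_neg (by omega)
      · exact absurd hM h2
  · rintro ⟨hkj, v, h1, rfl⟩
    obtain ⟨n, rfl⟩ := Nat.exists_eq_add_of_le hkj
    rw [Nat.add_sub_cancel_left]
    clear hkj
    induction n generalizing k q with
    | zero => exact ⟨[], rfl, rfl⟩
    | succ n ih =>
      obtain ⟨u, h2, h3⟩ := ih (k := k + 1) (q := δ q (v k)) fun i h4 h5 =>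
        h1 i (by omega) (by omega)
      obtain ⟨h4, h5⟩ := h1 k le_rfl (by omega)
      refine ⟨v k :: u, by rw [run_succ', ← h2]; rfl, h4, k + 1, .inl ⟨hM, rfl, h5⟩, ?_⟩
      rwa [show k + (n + 1) = k + 1 + n by omega]

/-- A backward path to `0` tests positions `k, …, 1`; folding its word from the right is the forward
run over `1, …, k`. The letter at `0` remains to be tested. -/
theorem exists_readPath_bwd {W : ℕ → Letter Pr} {M : Modality} (hM : ¬ M.Fwd) (δ : S → Λ → S)
    (L : Λ → Set ℕ) [Nonempty Λ] {k : ℕ} {q p : S} :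
    (∃ u : List Λ, u.foldr (fun a s => δ s a) q = p ∧ ReadPath (M.Move W) L k u 0) ↔
      ∃ v : ℕ → Λ, (∀ i, 1 ≤ i → i ≤ k → i ∈ L (v i)) ∧ run δ q v 1 k = p := by
  induction k generalizing p with
  | zero =>
    constructor
    · rintro ⟨_ | ⟨a, u⟩, rfl, h⟩
      · exact ⟨fun _ => Classical.arbitrary Λ, fun i _ _ => by omega, rfl⟩
      · obtain ⟨-, l, ⟨h1, -⟩ | ⟨-, h1⟩, -⟩ := h
        · exact absurd h1 hM
        · omega
    · rintro ⟨v, -, rfl⟩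
      exact ⟨[], rfl, rfl⟩
  | succ k ih =>
    constructor
    · rintro ⟨_ | ⟨a, u⟩, rfl, h⟩
      · have h : k + 1 = 0 := h
        omega
      · obtain ⟨h0, l, ⟨h1, -⟩ | ⟨-, h1⟩, h2⟩ := h
        · exact absurd h1 hM
        · obtain rfl : k = l := by omega
          obtain ⟨v, h3, h4⟩ := ih.1 ⟨u, rfl, h2⟩
          refine ⟨fun i => if i = k + 1 then a else v i, fun i h5 h6 => ?_, ?_⟩
          · dsimp only
            split_ifs with h7
            · exact h7 ▸ h0
            · exact h3 i h5 (by omega)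
          · rw [run, List.foldr_cons, ← h4, if_pos (by omega)]
            congr 1
            exact run_congr _ _ fun i _ h5 => if_neg (by omega)
    · rintro ⟨v, h1, rfl⟩
      obtain ⟨u, h2, h3⟩ := ih.2 ⟨v, fun i h4 h5 => h1 i h4 (by omega), rfl⟩
      refine ⟨v (k + 1) :: u, ?_, h1 _ (by omega) le_rfl, k, .inr ⟨hM, rfl⟩, h3⟩
      rw [List.foldr_cons, h2, run, add_comm 1 k]

variable [Finite S] [Finite Λ]

/-- A regular expression for the words leading from `q` to `p`. -/
noncomputable def fwdRegex (δ : S → Λ → S) (q p : S) : RegularExpression Λ :=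
  (exists_regex_foldl δ q p).choose

/-- A regular expression for the reversals of the words leading from `q` to `p`. -/
noncomputable def bwdRegex (δ : S → Λ → S) (q p : S) : RegularExpression Λ :=
  (exists_regex_foldr δ q p).choose

theorem mem_wsem_trans_fwd [Nonempty Λ] {W : ℕ → Letter Pr} {M : Modality} (hM : M.Fwd)
    (δ : S → Λ → S) (q p : S) (ℓ : Λ → Formula Pr) {z : Formula Pr} {k : ℕ} :
    k ∈ (trans M ℓ (fwdRegex δ q p) z).wsem W ↔ ∃ j, k ≤ j ∧ j ∈ z.wsem W ∧ ∃ v : ℕ → Λ,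
      (∀ i, k ≤ i → i < j → i ∈ (ℓ (v i)).wsem W ∧ (W (i + 1)).alive) ∧
        run δ q v k (j - k) = p := by
  rw [mem_wsem_trans]
  have := (exists_regex_foldl δ q p).choose_spec
  simp only [fwdRegex, this]
  constructor
  · rintro ⟨u, hu, j, h, hj⟩
    obtain ⟨h1, h2⟩ := (exists_readPath_fwd hM δ _).1 ⟨u, hu, h⟩
    exact ⟨j, h1, hj, h2⟩
  · rintro ⟨j, h1, hj, h2⟩
    obtain ⟨u, hu, h⟩ := (exists_readPath_fwd hM δ (fun a => (ℓ a).wsem W)).2 ⟨h1, h2⟩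
    exact ⟨u, hu, j, h, hj⟩

/-- A nonempty factor of type `p` leads to a position where `z` holds. -/
noncomputable def blockFormula (M : Modality) (δ : S → Λ → S) (s₀ p : S) (ℓ : Λ → Formula Pr)
    (z : Formula Pr) : Formula Pr :=
  orOver fun x => (ℓ x).and (.modal M (trans M ℓ (fwdRegex δ (δ s₀ x) p) z))

theorem Within.blockFormula {Ms : Set Modality} {B : Set ℕ} {M : Modality} (hM : M ∈ Ms)
    (δ : S → Λ → S) (s₀ p : S) {ℓ : Λ → Formula Pr} {z : Formula Pr}
    (hℓ : ∀ x, Within Ms B (ℓ x)) (hz : Within Ms B z) :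
    Within Ms B (blockFormula M δ s₀ p ℓ z) :=
  .orOver fun x => (hℓ x).and (.modal hM (.trans hM hℓ _ hz))

/-- The first letter is read apart from the regular expression, which forces `k < j`. This makes the
greatest fixpoint in `repeatFormula` advance at every unfolding. -/
theorem mem_wsem_blockFormula [Nonempty Λ] {W : ℕ → Letter Pr} {M : Modality} (hM : M.Fwd)
    (δ : S → Λ → S) (s₀ p : S) (ℓ : Λ → Formula Pr) {z : Formula Pr} {k : ℕ} :
    k ∈ (blockFormula M δ s₀ p ℓ z).wsem W ↔ ∃ j, k < j ∧ j ∈ z.wsem W ∧ ∃ v : ℕ → Λ,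
      (∀ i, k ≤ i → i < j → i ∈ (ℓ (v i)).wsem W ∧ (W (i + 1)).alive) ∧
        run δ s₀ v k (j - k) = p := by
  rw [blockFormula, mem_wsem_orOver]
  constructor
  · rintro ⟨x, hx, l, ⟨-, rfl, h1⟩ | ⟨h1, -⟩, h2⟩
    · obtain ⟨j, h3, h4, v, h5, h6⟩ := (mem_wsem_trans_fwd hM δ _ _ ℓ).1 h2
      refine ⟨j, by omega, h4, fun i => if i = k then x else v i, fun i h7 h8 => ?_, ?_⟩
      · dsimp only
        split_ifs with h9
        · exact h9 ▸ ⟨hx, h1⟩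
        · exact h5 i (by omega) h8
      · rw [show j - k = j - (k + 1) + 1 by omega, run_succ', ← h6]
        simp only [if_true]
        exact run_congr _ _ fun i h7 _ => if_neg (by omega)
    · exact absurd hM h1
  · rintro ⟨j, h1, h2, v, h3, rfl⟩
    obtain ⟨h4, h5⟩ := h3 k le_rfl h1
    refine ⟨v k, h4, k + 1, .inl ⟨hM, rfl, h5⟩, (mem_wsem_trans_fwd hM δ _ _ ℓ).2
      ⟨j, h1, h2, v, fun i h6 h7 => h3 i (by omega) h7, ?_⟩⟩
    rw [show j - k = j - (k + 1) + 1 by omega, run_succ']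

/-- There is an infinite sequence of consecutive factors of type `p`. -/
noncomputable def repeatFormula (M : Modality) (δ : S → Λ → S) (s₀ p : S) (ℓ : Λ → Formula Pr) :
    Formula Pr :=
  .nu (blockFormula M δ s₀ p (fun x => (ℓ x).rename Nat.succ) (.var 0))

theorem Within.repeatFormula {Ms : Set Modality} {B : Set ℕ} {M : Modality} (hM : M ∈ Ms)
    (δ : S → Λ → S) (s₀ p : S) {ℓ : Λ → Formula Pr} (hℓ : ∀ x, Within Ms B (ℓ x)) :
    Within Ms B (repeatFormula M δ s₀ p ℓ) :=
  (Within.blockFormula hM δ s₀ p (fun x => (hℓ x).rename_succ)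
    (within_var fun m hm => by omega)).nu

theorem mem_wsem_repeatFormula [Nonempty Λ] {W : ℕ → Letter Pr} {M : Modality} (hM : M.Fwd)
    (δ : S → Λ → S) (s₀ p : S) (ℓ : Λ → Formula Pr) {k : ℕ} :
    k ∈ (repeatFormula M δ s₀ p ℓ).wsem W ↔ ∃ g : ℕ → ℕ, StrictMono g ∧ g 0 = k ∧ ∃ v : ℕ → Λ,
      (∀ i, k ≤ i → i ∈ (ℓ (v i)).wsem W ∧ (W (i + 1)).alive) ∧
        ∀ n, run δ s₀ v (g n) (g (n + 1) - g n) = p := by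
  have e : ∀ A j, j ∈ (blockFormula M δ s₀ p (fun x => (ℓ x).rename Nat.succ)
      (.var 0)).wsem (consWord A W) ↔ ∃ j', j < j' ∧ j' ∈ A ∧ ∃ v : ℕ → Λ,
      (∀ i, j ≤ i → i < j' → i ∈ (ℓ (v i)).wsem W ∧ (W (i + 1)).alive) ∧
        run δ s₀ v j (j' - j) = p := by
    intro A j
    rw [mem_wsem_blockFormula hM]
    simp only [wsem_rename_succ]
    rfl
  constructor
  · rintro ⟨A, hA, hk⟩
    have : ∀ j : A, ∃ j' : A, (j : ℕ) < j' ∧ ∃ v : ℕ → Λ,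
        (∀ i, (j : ℕ) ≤ i → i < j' → i ∈ (ℓ (v i)).wsem W ∧ (W (i + 1)).alive) ∧
        run δ s₀ v j (j' - j) = p := by
      rintro ⟨j, hj⟩
      obtain ⟨j', h1, h2, h3⟩ := (e A j).1 (hA hj)
      exact ⟨⟨j', h2⟩, h1, h3⟩
    choose next h1 v h2 h3 using this
    -- Iterating the choice of a block inside the post-fixed point gives the cut points; the letters
    -- chosen for each block are then glued.
    let f : ℕ → A := fun n => next^[n] ⟨k, hk⟩
    have hf : ∀ n, f (n + 1) = next (f n) := fun n => Function.iterate_succ_apply' _ _ _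
    let g : ℕ → ℕ := fun n => f n
    have hg : StrictMono g := strictMono_nat_of_lt_succ fun n => by
      simp only [g, hf]
      exact h1 _
    obtain ⟨V, -, hV⟩ := exists_glue hg (fun _ => Classical.arbitrary Λ) (fun n => v (f n))
    refine ⟨g, hg, rfl, V, fun i hi => ?_, fun n => ?_⟩
    · obtain ⟨n, h4, h5⟩ := exists_block hg (i := i) hi
      rw [hV n i h4 h5]
      refine h2 _ i h4 ?_
      rw [← hf]
      exact h5
    · have h4 := h3 (f n)
      rw [← hf] at h4
      refine Eq.trans (run_congr _ _ fun i h5 h6 => hV n i h5 ?_) h4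
      have := hg (Nat.lt_add_one n)
      omega
  · rintro ⟨g, hg, rfl, v, h1, h2⟩
    refine ⟨Set.range g, ?_, 0, rfl⟩
    rintro _ ⟨n, rfl⟩
    exact (e _ _).2 ⟨g (n + 1), hg (by omega), ⟨_, rfl⟩, v,
      fun i h3 _ => h1 i ((hg.monotone (Nat.zero_le n)).trans h3), h2 n⟩

/-- The strict future is an infinite word, consisting of a factor of type `t` followed by
factors of type `p`. -/
noncomputable def futureInf (M : Modality) (δ : S → Λ → S) (s₀ t p : S) (ℓ : Λ → Formula Pr) :
    Formula Pr :=
  .modal M (blockFormula M δ s₀ t ℓ (repeatFormula M δ s₀ p ℓ))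

theorem mem_wsem_futureInf [Nonempty Λ] {W : ℕ → Letter Pr} {M : Modality} (hM : M.Fwd)
    (δ : S → Λ → S) (s₀ t p : S) (ℓ : Λ → Formula Pr) {k : ℕ} :
    k ∈ (futureInf M δ s₀ t p ℓ).wsem W ↔ ∃ g : ℕ → ℕ, StrictMono g ∧ g 0 = k + 1 ∧
      ∃ v : ℕ → Λ, (∀ i, k < i → i ∈ (ℓ (v i)).wsem W ∧ (W i).alive) ∧
        run δ s₀ v (g 0) (g 1 - g 0) = t ∧
        ∀ n, run δ s₀ v (g (n + 1)) (g (n + 2) - g (n + 1)) = p := by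
  constructor
  · rintro ⟨l, ⟨-, rfl, h0⟩ | ⟨h1, -⟩, h2⟩
    · obtain ⟨j, h3, h4, v, h5, h6⟩ := (mem_wsem_blockFormula hM ..).1 h2
      obtain ⟨g, hg, rfl, v', h7, h8⟩ := (mem_wsem_repeatFormula hM ..).1 h4
      refine ⟨fun n => match n with | 0 => k + 1 | n + 1 => g n,
        strictMono_nat_of_lt_succ fun n => ?_, rfl, fun i => if i < g 0 then v i else v' i,
        fun i hi => ⟨?_, ?_⟩, ?_, fun n => ?_⟩
      · cases n with
        | zero => exact h3
        | succ n => exact hg (by omega)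
      · dsimp only
        split_ifs with h9
        · exact (h5 i hi h9).1
        · exact (h7 i (by omega)).1
      · obtain ⟨i, rfl⟩ : ∃ i', i = i' + 1 := ⟨i - 1, by omega⟩
        by_cases h9 : i = k
        · rwa [h9]
        by_cases h10 : i < g 0
        · exact (h5 i (by omega) h10).2
        · exact (h7 i (by omega)).2
      · change run δ s₀ (fun i => if i < g 0 then v i else v' i) (k + 1) (g 0 - (k + 1)) = t
        rw [← h6]
        exact run_congr _ _ fun i _ _ => if_pos (by omega)
      · change run δ s₀ (fun i => if i < g 0 then v i else v' i) (g n) (g (n + 1) - g n) = p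
        rw [← h8 n]
        refine run_congr _ _ fun i h9 _ => if_neg ?_
        have := hg.monotone (Nat.zero_le n)
        omega
    · exact absurd hM h1
  · rintro ⟨g, hg, h0, v, h1, h2, h3⟩
    have h01 : g 0 < g 1 := hg (Nat.lt_add_one 0)
    refine ⟨k + 1, .inl ⟨hM, rfl, (h1 _ (by omega)).2⟩, (mem_wsem_blockFormula hM ..).2
      ⟨g 1, by omega, (mem_wsem_repeatFormula hM ..).2 ⟨fun n => g (n + 1),
        fun a b h => hg (by omega), rfl, v, fun i h4 => ?_, h3⟩, v, fun i h4 _ => ?_, ?_⟩⟩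
    · exact ⟨(h1 i (by omega)).1, (h1 _ (by omega)).2⟩
    · exact ⟨(h1 i (by omega)).1, (h1 _ (by omega)).2⟩
    · rw [← h0]
      exact h2

open Classical in
/-- The strict future is a finite word of type `t`. -/
noncomputable def futureFin (M : Modality) (last : Atom Pr) (δ : S → Λ → S) (s₀ t : S)
    (ℓ : Λ → Formula Pr) : Formula Pr :=
  .or (if s₀ = t then .atom last else falsum)
    -- The first disjunct covers the empty future. Otherwise the last letter is read apart, since
    -- `trans` moves after each letter and the last position has no successor.
    (.modal M (orOver fun x : {x : S × Λ // δ x.1 x.2 = t} =>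
      trans M ℓ (fwdRegex δ s₀ x.1.1) ((ℓ x.1.2).and (.atom last))))

theorem mem_wsem_futureFin [Nonempty Λ] {W : ℕ → Letter Pr} {M : Modality} (hM : M.Fwd)
    {last : Atom Pr} (hW : ∀ k, (W k).atoms last ↔ (W k).alive ∧ ¬ (W (k + 1)).alive)
    (δ : S → Λ → S) (s₀ t : S) (ℓ : Λ → Formula Pr) {k : ℕ} (hk : (W k).alive) :
    k ∈ (futureFin M last δ s₀ t ℓ).wsem W ↔ ∃ n, k < n ∧ ¬ (W n).alive ∧ ∃ v : ℕ → Λ,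
      (∀ i, k < i → i < n → i ∈ (ℓ (v i)).wsem W ∧ (W i).alive) ∧
        run δ s₀ v (k + 1) (n - (k + 1)) = t := by
  constructor
  · rintro (h | ⟨l, ⟨-, rfl, h0⟩ | ⟨h1, -⟩, h2⟩)
    · split_ifs at h with h1
      · exact ⟨k + 1, by omega, ((hW k).1 h).2, fun _ => Classical.arbitrary Λ,
          fun i _ _ => by omega, by simpa [run] using h1⟩
      · simp at h
    · obtain ⟨⟨⟨q, x⟩, rfl⟩, h3⟩ := mem_wsem_orOver.1 h2
      obtain ⟨j, h4, ⟨h5, h6⟩, v, h7, h8⟩ := (mem_wsem_trans_fwd hM ..).1 h3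
      have h6 := (hW j).1 h6
      refine ⟨j + 1, by omega, h6.2, fun i => if i = j then x else v i, fun i h9 h10 => ⟨?_, ?_⟩, ?_⟩
      · dsimp only
        split_ifs with h11
        · exact h11 ▸ h5
        · exact (h7 i (by omega) (by omega)).1
      · obtain ⟨i, rfl⟩ : ∃ i', i = i' + 1 := ⟨i - 1, by omega⟩
        by_cases h9 : i = k
        · rwa [h9]
        · exact (h7 i (by omega) (by omega)).2
      · rw [show j + 1 - (k + 1) = j - (k + 1) + 1 by omega, run, if_pos (by omega)]
        dsimp only at h8 ⊢
        rw [← h8]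
        congr 1
        exact run_congr _ _ fun i _ _ => if_neg (by omega)
    · exact absurd hM h1
  · rintro ⟨n, h1, h2, v, h3, rfl⟩
    by_cases hn : n = k + 1
    · subst hn
      left
      rw [if_pos (by simp [run])]
      exact (hW k).2 ⟨hk, h2⟩
    · right
      refine ⟨k + 1, .inl ⟨hM, rfl, (h3 _ (by omega) (by omega)).2⟩, mem_wsem_orOver.2
        ⟨⟨(run δ s₀ v (k + 1) (n - 1 - (k + 1)), v (n - 1)), ?_⟩, (mem_wsem_trans_fwd hM ..).2
          ⟨n - 1, by omega, ⟨(h3 _ (by omega) (by omega)).1, (hW _).2 ⟨(h3 _ (by omega)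
            (by omega)).2, ?_⟩⟩, v, fun i h4 h5 => ?_, rfl⟩⟩⟩
      · rw [show n - (k + 1) = n - 1 - (k + 1) + 1 by omega, run,
          show k + 1 + (n - 1 - (k + 1)) = n - 1 by omega]
      · rwa [show n - 1 + 1 = n by omega]
      · exact ⟨(h3 i (by omega) (by omega)).1, (h3 _ (by omega) (by omega)).2⟩

/-- The past, including the current position, is a word of type `s`, the state reached by the
current position being computed with `δ'` instead of `δ`. -/
noncomputable def pastFormula (M : Modality) (first : Atom Pr) (δ δ' : S → Λ → S) (s₀ s : S)
    (ℓ : Λ → Formula Pr) : Formula Pr :=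
  .or (orOver fun x : {x : Λ // δ' s₀ x = s} => (ℓ x.1).and (.atom first))
    -- Two letters are read apart: the current one, which uses `δ'`, and the first one, `y`, from
    -- which no backward move is possible.
    (orOver fun x : {x : S × Λ // δ' x.1 x.2 = s} => (ℓ x.1.2).and (.modal M
      (orOver fun y => trans M ℓ (bwdRegex δ (δ s₀ y) x.1.1) ((ℓ y).and (.atom first)))))

theorem mem_wsem_pastFormula [Nonempty Λ] {W : ℕ → Letter Pr} {M : Modality} (hM : ¬ M.Fwd)
    {first : Atom Pr} (hW : ∀ k, (W k).atoms first ↔ k = 0)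
    (δ δ' : S → Λ → S) (s₀ s : S) (ℓ : Λ → Formula Pr) {k : ℕ} :
    k ∈ (pastFormula M first δ δ' s₀ s ℓ).wsem W ↔ ∃ v : ℕ → Λ,
      (∀ i, i ≤ k → i ∈ (ℓ (v i)).wsem W) ∧ δ' (run δ s₀ v 0 k) (v k) = s := by
  constructor
  · rintro (h | h)
    · obtain ⟨⟨x, rfl⟩, h1, h2⟩ := mem_wsem_orOver.1 h
      obtain rfl := (hW k).1 h2
      refine ⟨fun _ => x, fun i hi => ?_, rfl⟩
      obtain rfl : i = 0 := by omega
      exact h1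
    · obtain ⟨⟨⟨q, x⟩, rfl⟩, h1, l, ⟨h2, -⟩ | ⟨-, rfl⟩, h3⟩ := mem_wsem_orOver.1 h
      · exact absurd h2 hM
      · obtain ⟨y, h4⟩ := mem_wsem_orOver.1 h3
        obtain ⟨u, hu, j, h5, h6, h7⟩ := mem_wsem_trans.1 h4
        obtain rfl := (hW j).1 h7
        obtain ⟨v, h8, h9⟩ := (exists_readPath_bwd hM δ _).1
          ⟨u, ((exists_regex_foldr δ (δ s₀ y) q).choose_spec u).1 hu, h5⟩
        refine ⟨fun i => if i = 0 then y else if i = l + 1 then x else v i, fun i hi => ?_, ?_⟩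
        · dsimp only
          split_ifs with h10 h11
          · exact h10 ▸ h6
          · exact h11 ▸ h1
          · exact h8 i (by omega) (by omega)
        · rw [run_succ', ← h9]
          simp only [if_true, if_neg (Nat.succ_ne_zero l)]
          congr 1
          refine run_congr _ _ fun i h10 h11 => ?_
          rw [if_neg (by omega), if_neg (by omega)]
  · rintro ⟨v, h1, rfl⟩
    cases k with
    | zero => exact .inl (mem_wsem_orOver.2 ⟨⟨v 0, rfl⟩, h1 0 le_rfl, (hW 0).2 rfl⟩)
    | succ k =>
      refine .inr (mem_wsem_orOver.2 ⟨⟨(run δ s₀ v 0 (k + 1), v (k + 1)), rfl⟩, h1 _ le_rfl, k,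
        .inr ⟨hM, rfl⟩, mem_wsem_orOver.2 ⟨v 0, mem_wsem_trans.2 ?_⟩⟩)
      obtain ⟨u, h2, h3⟩ := (exists_readPath_bwd (k := k) hM δ fun a => (ℓ a).wsem W).2
        ⟨v, fun i _ h4 => h1 i (by omega), rfl⟩
      refine ⟨u, ((exists_regex_foldr δ _ _).choose_spec u).2 (h2.trans ?_), 0, h3,
        h1 0 (by omega), (hW 0).2 rfl⟩
      rw [run_succ']

end Types

/-! ### Separation of the past and the future -/

/-- The positions that exist form an initial segment, on which `first` and `last` have their
expected meaning. -/
structure IsChainWord (first last : Atom Pr) (W : ℕ → Letter Pr) : Prop where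
  alive_of_succ : ∀ k, (W (k + 1)).alive → (W k).alive
  eq_dead : ∀ k, ¬ (W k).alive → W k = deadLetter Pr
  first_iff : ∀ k, (W k).atoms first ↔ k = 0
  last_iff : ∀ k, (W k).atoms last ↔ (W k).alive ∧ ¬ (W (k + 1)).alive

theorem IsChainWord.alive_of_le {first last : Atom Pr} {W : ℕ → Letter Pr}
    (hW : IsChainWord first last W) {i k : ℕ} (h : i ≤ k) (hk : (W k).alive) : (W i).alive := by
  induction k, h using Nat.le_induction with
  | base => exact hk
  | succ k _ ih => exact ih (hW.alive_of_succ k hk)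

section Reduced

variable (φ : Formula Pr)

/-- The part of a label on which a formula depends. -/
abbrev ReducedLetter : Type _ := Set {a // φ.HasAtom a} × Set {n // φ.FreeIn n}

instance : Finite {a // φ.HasAtom a} := (finite_hasAtom φ).to_subtype

instance : Finite {n // φ.FreeIn n} := (finite_freeIn φ).to_subtype

variable {φ}

/-- The label with a given reduced label in which no other atom or variable holds. -/
def ReducedLetter.toLetter (x : ReducedLetter φ) : Letter Pr :=
  ⟨fun a => ∃ h, ⟨a, h⟩ ∈ x.1, fun n => ∃ h, ⟨n, h⟩ ∈ x.2, True⟩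

/-- The label has the same relevant atoms as the reduced label, and at least its variables. -/
def Covers (x : ReducedLetter φ) (l : Letter Pr) : Prop :=
  (∀ a, a ∈ x.1 ↔ l.atoms a) ∧ ∀ n ∈ x.2, l.vars n

variable (φ) in
/-- The reduced label of a label. -/
def reduce (l : Letter Pr) : ReducedLetter φ := ({a | l.atoms a}, {n | l.vars n})

theorem covers_reduce (l : Letter Pr) : Covers (reduce φ l) l := ⟨fun _ => Iff.rfl, fun _ => id⟩

open Classical in
/-- A formula saying that the label of the current position covers a reduced label. -/
noncomputable def coverFormula (x : ReducedLetter φ) : Formula Pr :=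
  .and (andOver fun a : {a // φ.HasAtom a} => if a ∈ x.1 then .atom a.1 else .natom a.1)
    (andOver fun n : {n // φ.FreeIn n} => if n ∈ x.2 then .var n.1 else verum)

theorem within_coverFormula (Ms : Set Modality) (x : ReducedLetter φ) :
    Within Ms {n | φ.FreeIn n} (coverFormula x) := by
  classical
  refine (Within.andOver fun a => ?_).and (Within.andOver fun n => ?_)
  · split_ifs
    exacts [within_atom _, within_natom _]
  · split_ifs
    exacts [within_var n.2, within_verum]

/-- Atoms can be tested exactly, but the syntax has no negated variables, so `Covers` is the most
that a formula can assert about a label. -/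
theorem mem_wsem_coverFormula {x : ReducedLetter φ} {W : ℕ → Letter Pr} {k : ℕ} :
    k ∈ (coverFormula x).wsem W ↔ Covers x (W k) := by
  classical
  rw [coverFormula, Formula.wsem, Set.mem_inter_iff, mem_wsem_andOver, mem_wsem_andOver]
  refine and_congr (forall_congr' fun a => ?_) (forall_congr' fun n => ?_)
  · split_ifs with h
    · simp [Formula.wsem, h]
    · simp [Formula.wsem, h]
  · split_ifs with h
    · simp [Formula.wsem, h]
    · simp [h]

end Reduced

/-- The sequence `s, t, p, p, …`. -/
def typeSeq {S : Type*} (s t p : S) : ℕ → S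
  | 0 => s
  | 1 => t
  | _ + 2 => p

/-- A two-way formula is equivalent to a finite disjunction of conjunctions of a formula about the
past and a formula about the future. -/
theorem exists_separation (φ : Formula Pr) (first last : Atom Pr) {X Y : Modality}
    (hX : X.Fwd) (hY : ¬ Y.Fwd) :
    ∃ l : List (Formula Pr × Formula Pr),
      (∀ p ∈ l, Within {Y} {n | φ.FreeIn n} p.1 ∧ Within {X} {n | φ.FreeIn n} p.2) ∧
      ∀ W, IsChainWord first last W → ∀ k, (W k).alive →
        (k ∈ φ.wsem W ↔ ∃ p ∈ l, k ∈ p.1.wsem W ∧ k ∈ p.2.wsem W) := by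
  classical
  obtain ⟨S, _, step, s₀, hrec⟩ := recognizable_subset_wsem φ
  -- The second component marks the position where `φ` is evaluated: `δ'` reads the marked letter,
  -- `δ` an unmarked one, `dead` a position past the end.
  let δ : S → ReducedLetter φ → S := fun s x => step s (x.toLetter, False)
  let δ' : S → ReducedLetter φ → S := fun s x => step s (x.toLetter, True)
  let dead : S → S := fun s => step s (deadLetter Pr, False)
  -- By recognizability, one witness for a type sequence makes every word with a factorization of
  -- these types satisfy the property.
  let Good : (ℕ → S) → Prop := fun τ => ∃ (U : ℕ → Letter Pr × Prop) (g : ℕ → ℕ), IsCut g ∧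
    (∀ k, run step s₀ U (g k) (g (k + 1) - g k) = τ k) ∧
    ∀ k, (U k).2 → k ∈ φ.wsem fun k => (U k).1
  let past : S → Formula Pr := fun s => pastFormula Y first δ δ' s₀ s coverFormula
  let inf : S → S → Formula Pr := fun t p => futureInf X δ s₀ t p coverFormula
  let fin : S → Formula Pr := fun t => futureFin X last δ s₀ t coverFormula
  have hpast : ∀ s, Within {Y} {n | φ.FreeIn n} (past s) := fun s =>
    have hc := within_coverFormula (φ := φ) {Y}
    (Within.orOver fun x => (hc _).and (within_atom _)).or (.orOver fun x => (hc _).and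
      (.modal (Set.mem_singleton _) (.orOver fun y => .trans (Set.mem_singleton _) hc _ ((hc _).and (within_atom _)))))
  have hinf : ∀ t p, Within {X} {n | φ.FreeIn n} (inf t p) := fun t p =>
    have hc := within_coverFormula (φ := φ) {X}
    Within.modal (Set.mem_singleton _) (.blockFormula (Set.mem_singleton _) _ _ _ hc (.repeatFormula (Set.mem_singleton _) _ _ _ hc))
  have hfin : ∀ t, Within {X} {n | φ.FreeIn n} (fin t) := by
    intro t
    have hc := within_coverFormula (φ := φ) {X}
    refine Within.or ?_ (.modal (Set.mem_singleton _) (.orOver fun x =>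
      .trans (Set.mem_singleton _) hc _ ((hc _).and (within_atom _))))
    split_ifs
    exacts [within_atom _, within_falsum]
  let I : Finset (S × S × S) :=
    (Set.toFinite {i : S × S × S | Good (typeSeq i.1 i.2.1 i.2.2)}).toFinset
  -- In a finite word the first block after the prefix ends with one dead letter, and each later
  -- block is a single dead letter.
  let J : Finset (S × S) :=
    (Set.toFinite {i : S × S | Good (typeSeq i.1 (dead i.2) (dead s₀))}).toFinset
  have hI : ∀ i, i ∈ I ↔ Good (typeSeq i.1 i.2.1 i.2.2) := fun i => by simp [I]
  have hJ : ∀ i, i ∈ J ↔ Good (typeSeq i.1 (dead i.2) (dead s₀)) := fun i => by simp [J]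
  refine ⟨I.toList.map (fun i => (past i.1, inf i.2.1 i.2.2)) ++
    J.toList.map (fun i => (past i.1, fin i.2)), ?_, fun W hW k hk => ?_⟩
  · intro p hp
    rcases List.mem_append.1 hp with hp | hp
    · obtain ⟨i, -, rfl⟩ := List.mem_map.1 hp
      exact ⟨hpast _, hinf _ _⟩
    · obtain ⟨i, -, rfl⟩ := List.mem_map.1 hp
      exact ⟨hpast _, hfin _⟩
  have hmem : (∃ p ∈ I.toList.map (fun i => (past i.1, inf i.2.1 i.2.2)) ++
      J.toList.map (fun i => (past i.1, fin i.2)), k ∈ p.1.wsem W ∧ k ∈ p.2.wsem W) ↔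
      (∃ s t p, Good (typeSeq s t p) ∧ k ∈ (past s).wsem W ∧ k ∈ (inf t p).wsem W) ∨
      ∃ s t, Good (typeSeq s (dead t) (dead s₀)) ∧
        k ∈ (past s).wsem W ∧ k ∈ (fin t).wsem W := by
    simp only [List.mem_append, List.mem_map, Finset.mem_toList, hI, hJ, or_and_right, exists_or]
    refine or_congr ⟨?_, ?_⟩ ⟨?_, ?_⟩
    · rintro ⟨_, ⟨i, h, rfl⟩, h'⟩
      exact ⟨_, _, _, h, h'⟩
    · rintro ⟨s, t, p, h, h'⟩
      exact ⟨_, ⟨(s, t, p), h, rfl⟩, h'⟩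
    · rintro ⟨_, ⟨i, h, rfl⟩, h'⟩
      exact ⟨_, _, h, h'⟩
    · rintro ⟨s, t, h, h'⟩
      exact ⟨_, ⟨(s, t), h, rfl⟩, h'⟩
  have hpw := fun s => mem_wsem_pastFormula (W := W) hY hW.first_iff δ δ' s₀ s
    (coverFormula (φ := φ)) (k := k)
  simp only [mem_wsem_coverFormula] at hpw
  -- `U v` has the guessed labels `v` at the live positions and its only mark at `k`. Covering
  -- guesses give a denotation below that of `W` (`hUW`); the exact reduced labels also give the
  -- converse inclusion (`hWU`).
  let U : (ℕ → ReducedLetter φ) → ℕ → Letter Pr × Prop := fun v i =>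
    (if (W i).alive then (v i).toLetter else deadLetter Pr, i = k)
  have hUdead : ∀ v i, ¬ (W i).alive → (U v i).1 = W i := fun v i hi =>
    (if_neg hi).trans (hW.eq_dead i hi).symm
  have hUalive : ∀ v i, (W i).alive → (U v i).1 = (v i).toLetter := fun v i hi => if_pos hi
  have hUl : ∀ v i, (U v i).1.alive ↔ (W i).alive := by
    intro v i
    by_cases hi : (W i).alive
    · rw [hUalive v i hi]
      exact ⟨fun _ => hi, fun _ => trivial⟩
    · rw [hUdead v i hi]
  have hUW : ∀ v, (∀ i, (W i).alive → Covers (v i) (W i)) →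
      (φ.wsem fun i => (U v i).1) ⊆ φ.wsem W := by
    intro v hv
    refine wsem_mono φ (fun i a ha => ?_) (fun i n hn => ?_) (hUl v)
    · by_cases hi : (W i).alive
      · rw [hUalive v i hi, ← (hv i hi).1 ⟨a, ha⟩]
        exact ⟨fun ⟨_, h⟩ => h, fun h => ⟨ha, h⟩⟩
      · rw [hUdead v i hi]
    · by_cases hi : (W i).alive
      · rw [hUalive v i hi]
        rintro ⟨h, h'⟩
        exact (hv i hi).2 _ h'
      · rw [hUdead v i hi]
        exact id
  have hWU : ∀ v, (∀ i, v i = reduce φ (W i)) → φ.wsem W ⊆ φ.wsem fun i => (U v i).1 := by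
    intro v hv
    refine wsem_mono φ (fun i a ha => ?_) (fun i n hn => ?_) fun i => (hUl v i).symm
    · by_cases hi : (W i).alive
      · rw [hUalive v i hi, hv]
        exact ⟨fun h => ⟨ha, h⟩, fun ⟨_, h⟩ => h⟩
      · rw [hUdead v i hi]
    · by_cases hi : (W i).alive
      · rw [hUalive v i hi, hv]
        exact fun h => ⟨hn, h⟩
      · rw [hUdead v i hi]
        exact id
  have hrun : ∀ v a n, (∀ i, a ≤ i → i < a + n → i ≠ k ∧ (W i).alive) →
      run step s₀ (U v) a n = run δ s₀ v a n := by
    intro v a n h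
    rw [← run_comp step s₀ (fun x : ReducedLetter φ => (x.toLetter, False)) v]
    refine run_congr _ _ fun i h1 h2 => ?_
    simp [U, h i h1 h2]
  have hrun₀ : ∀ v, run step s₀ (U v) 0 (k + 1) = δ' (run δ s₀ v 0 k) (v k) := by
    intro v
    rw [run, hrun v 0 k fun i _ h => ⟨by omega, hW.alive_of_le (by omega) hk⟩]
    simp [U, hk, δ']
  have hrun₁ : ∀ v n, k < n → ¬ (W n).alive → (∀ i, k < i → i < n → (W i).alive) →
      run step s₀ (U v) (k + 1) (n - k) = dead (run δ s₀ v (k + 1) (n - (k + 1))) := by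
    intro v n h1 h2 h3
    rw [show n - k = n - (k + 1) + 1 by omega, run,
      hrun v (k + 1) _ fun i _ h => ⟨by omega, h3 i (by omega) (by omega)⟩,
      show k + 1 + (n - (k + 1)) = n by omega]
    have : n ≠ k := by omega
    simp [U, h2, this, dead]
  have hrun₂ : ∀ v n, k < n → ¬ (W n).alive → run step s₀ (U v) n 1 = dead s₀ := by
    intro v n h1 h2
    have : n ≠ k := by omega
    simp [run, U, h2, this, dead]
  have hcutInf : ∀ (g : ℕ → ℕ) v, StrictMono g → g 0 = k + 1 → (∀ i, (W i).alive) →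
      ∀ s t p, δ' (run δ s₀ v 0 k) (v k) = s → run δ s₀ v (g 0) (g 1 - g 0) = t →
      (∀ n, run δ s₀ v (g (n + 1)) (g (n + 2) - g (n + 1)) = p) →
      ∃ G, IsCut G ∧ ∀ j, run step s₀ (U v) (G j) (G (j + 1) - G j) = typeSeq s t p j := by
    intro g v hg h0 ha s t p hs ht hp
    have hgk : ∀ n, k < g n := fun n => by
      have := hg.monotone (Nat.zero_le n)
      omega
    refine ⟨fun j => match j with | 0 => 0 | j + 1 => g j,
      ⟨strictMono_nat_of_lt_succ fun j => ?_, rfl⟩, fun j => ?_⟩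
    · cases j with
      | zero => exact Nat.zero_lt_of_lt (hgk 0)
      | succ j => exact hg (Nat.lt_add_one j)
    · have hr : ∀ j, run step s₀ (U v) (g j) (g (j + 1) - g j) =
          run δ s₀ v (g j) (g (j + 1) - g j) := fun j =>
        hrun v _ _ fun i h1 _ => ⟨((hgk j).trans_le h1).ne', ha i⟩
      match j with
      | 0 => exact (congrArg (run step s₀ (U v) 0) h0).trans ((hrun₀ v).trans hs)
      | 1 => exact (hr 0).trans ht
      | j + 2 => exact (hr (j + 1)).trans (hp j)
  have hcutFin : ∀ n v, k < n → (∀ i, i < n → (W i).alive) → (∀ i, n ≤ i → ¬ (W i).alive) →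
      ∀ s t, δ' (run δ s₀ v 0 k) (v k) = s → run δ s₀ v (k + 1) (n - (k + 1)) = t →
      ∃ G, IsCut G ∧ ∀ j, run step s₀ (U v) (G j) (G (j + 1) - G j) =
        typeSeq s (dead t) (dead s₀) j := by
    intro n v h1 h2 h3 s t hs ht
    -- The second block includes the first dead position `n`, so it is nonempty even when `k` is the
    -- last live position.
    refine ⟨fun j => match j with | 0 => 0 | 1 => k + 1 | j + 2 => n + 1 + j,
      ⟨strictMono_nat_of_lt_succ fun j => ?_, rfl⟩, fun j => ?_⟩
    · match j with
      | 0 => exact Nat.succ_pos k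
      | 1 => change k + 1 < n + 1 + 0; omega
      | j + 2 => change n + 1 + j < n + 1 + (j + 1); omega
    · match j with
      | 0 => exact (hrun₀ v).trans hs
      | 1 =>
        change run step s₀ (U v) (k + 1) (n + 1 + 0 - (k + 1)) = dead t
        rw [show n + 1 + 0 - (k + 1) = n - k by omega,
          hrun₁ v n h1 (h3 n le_rfl) fun i _ h => h2 i h, ht]
      | j + 2 =>
        change run step s₀ (U v) (n + 1 + j) (n + 1 + (j + 1) - (n + 1 + j)) = dead s₀
        rw [show n + 1 + (j + 1) - (n + 1 + j) = 1 by omega,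
          hrun₂ v _ (by omega) (h3 _ (by omega))]
  have hsound : ∀ τ v, Good τ → (∀ i, (W i).alive → Covers (v i) (W i)) →
      (∃ G, IsCut G ∧ ∀ j, run step s₀ (U v) (G j) (G (j + 1) - G j) = τ j) →
      k ∈ φ.wsem W := by
    rintro τ v ⟨U', g, hg, h1, h2⟩ hv ⟨G, hG, h3⟩
    exact hUW v hv (hrec U' (U v) g G hg hG (fun j => (h1 j).trans (h3 j).symm) h2 k rfl)
  have hcomplete : ∀ τ, k ∈ φ.wsem W → (∃ G, IsCut G ∧ ∀ j,
      run step s₀ (U fun i => reduce φ (W i)) (G j) (G (j + 1) - G j) = τ j) → Good τ := by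
    rintro τ h ⟨G, hG, h3⟩
    exact ⟨_, G, hG, h3, fun j hj => (show j = k from hj) ▸ hWU _ (fun _ => rfl) h⟩
  rw [hmem]
  constructor
  · intro h
    have hp := (hpw _).2 ⟨fun i => reduce φ (W i), fun i _ => covers_reduce _, rfl⟩
    by_cases ha : ∀ i, (W i).alive
    -- Ramsey: after a first block starting at `k + 1`, all blocks have one type `p`, so a pair `(t,
    -- p)` describes the infinite future.
    · obtain ⟨p, g, hg, h0, hgp⟩ := exists_strictMono_const_color
        (fun a b => run δ s₀ (fun i => reduce φ (W i)) a (b - a)) (k + 1)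
      have hg' : StrictMono fun j => match j with | 0 => k + 1 | j + 1 => g j :=
        strictMono_nat_of_lt_succ fun j => by
          cases j with
          | zero => exact h0
          | succ j => exact hg (Nat.lt_add_one j)
      refine .inl ⟨_, _, p, hcomplete _ h (hcutInf _ _ hg' rfl ha _ _ _ rfl rfl hgp), hp, ?_⟩
      refine (mem_wsem_futureInf hX ..).2 ⟨_, hg', rfl, fun i => reduce φ (W i), fun i _ =>
        ⟨mem_wsem_coverFormula.2 (covers_reduce _), ha i⟩, rfl, hgp⟩
    · rw [not_forall] at ha
      have h1 := Nat.find_spec ha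
      have h2 : ∀ i, i < Nat.find ha → (W i).alive := fun i hi => not_not.1 (Nat.find_min ha hi)
      have h3 : ∀ i, Nat.find ha ≤ i → ¬ (W i).alive := fun i hi h => h1 (hW.alive_of_le hi h)
      have h4 : k < Nat.find ha := not_le.1 fun h => h3 k h hk
      refine .inr ⟨_, _, hcomplete _ h (hcutFin _ _ h4 h2 h3 _ _ rfl rfl), hp, ?_⟩
      exact (mem_wsem_futureFin hX hW.last_iff _ _ _ _ hk).2 ⟨_, h4, h1, fun i => reduce φ (W i),
        fun i _ hi => ⟨mem_wsem_coverFormula.2 (covers_reduce _), h2 i hi⟩, rfl⟩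
  -- The past and the future formula guess labels independently, on the disjoint ranges `i ≤ k` and
  -- `k < i`; the two guesses combine into one.
  · have hjoin : ∀ v₁ v₂ : ℕ → ReducedLetter φ,
        δ' (run δ s₀ (fun i => if i ≤ k then v₁ i else v₂ i) 0 k) (if k ≤ k then v₁ k else v₂ k) =
          δ' (run δ s₀ v₁ 0 k) (v₁ k) ∧ ∀ a n, k < a →
          run δ s₀ (fun i => if i ≤ k then v₁ i else v₂ i) a n = run δ s₀ v₂ a n := by
      intro v₁ v₂
      refine ⟨?_, fun a n h => run_congr _ _ fun i _ _ => if_neg (by omega)⟩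
      rw [if_pos le_rfl]
      congr 1
      exact run_congr _ _ fun i _ _ => if_pos (by omega)
    rintro (⟨s, t, p, hgood, h1, h2⟩ | ⟨s, t, hgood, h1, h2⟩)
    · obtain ⟨v₁, h3, rfl⟩ := (hpw _).1 h1
      obtain ⟨g, hg, h0, v₂, h4, rfl, h5⟩ := (mem_wsem_futureInf hX ..).1 h2
      obtain ⟨j1, j2⟩ := hjoin v₁ v₂
      have hgk : ∀ n, k < g n := fun n => by
        have := hg.monotone (Nat.zero_le n)
        omega
      have ha : ∀ i, (W i).alive := fun i => by
        by_cases hi : i ≤ k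
        · exact hW.alive_of_le hi hk
        · exact (h4 i (by omega)).2
      refine hsound _ (fun i => if i ≤ k then v₁ i else v₂ i) hgood (fun i _ => ?_)
        (hcutInf g _ hg h0 ha _ _ _ j1 (j2 _ _ (hgk 0)) fun n => (j2 _ _ (hgk _)).trans (h5 n))
      split_ifs with hi
      · exact h3 i hi
      · exact mem_wsem_coverFormula.1 (h4 i (by omega)).1
    · obtain ⟨v₁, h3, rfl⟩ := (hpw _).1 h1
      obtain ⟨n, h6, h7, v₂, h4, rfl⟩ := (mem_wsem_futureFin hX hW.last_iff _ _ _ _ hk).1 h2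
      obtain ⟨j1, j2⟩ := hjoin v₁ v₂
      have ha : ∀ i, i < n → (W i).alive := fun i hi => by
        by_cases hi : i ≤ k
        · exact hW.alive_of_le hi hk
        · exact (h4 i (by omega) (by omega)).2
      have hd : ∀ i, n ≤ i → ¬ (W i).alive := fun i hi h => h7 (hW.alive_of_le hi h)
      refine hsound _ (fun i => if i ≤ k then v₁ i else v₂ i) hgood (fun i hi => ?_)
        (hcutFin n _ h6 ha hd _ _ j1 (j2 _ _ (by omega)))
      split_ifs with hik
      · exact h3 i hik
      · exact mem_wsem_coverFormula.1
          (h4 i (by omega) (not_le.1 fun h => hd i h hi)).1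

/-! ### Transfer to data words -/

/-- `c` enumerates the positions of a maximal chain of the partial function `R`; it is `none` from
the end of the chain on. -/
structure IsChain {D : Type*} (R : D → D → Prop) (c : ℕ → Option D) : Prop where
  step_iff : ∀ k x y, c k = some x → (R x y ↔ c (k + 1) = some y)
  pred : ∀ k x y, c k = some x → R y x → ∃ l, k = l + 1 ∧ c l = some y
  of_succ : ∀ k x, c (k + 1) = some x → ∃ y, c k = some y
  inj : ∀ k l x, c k = some x → c l = some x → k = l

/-- Well-foundedness leads from `x` down to a root without an `R`-predecessor, from which the chain
is enumerated forward. Strict increase along `R` makes the enumeration injective. -/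
theorem exists_isChain {D : Type*} [LinearOrder D] [WellFoundedLT D] {R : D → D → Prop}
    (hfun : ∀ x y z, R x y → R x z → y = z) (hinj : ∀ x y z, R x z → R y z → x = y)
    (hlt : ∀ x y, R x y → x < y) (x : D) : ∃ c k, IsChain R c ∧ c k = some x := by
  classical
  let next : D → Option D := fun x => if h : ∃ y, R x y then some h.choose else none
  have hnext : ∀ x y, R x y ↔ next x = some y := by
    intro x y
    simp only [next]
    split_ifs with h
    · simp only [Option.some.injEq]
      exact ⟨fun h' => hfun _ _ _ h.choose_spec h', fun h' => h' ▸ h.choose_spec⟩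
    · simp only [iff_false]
      exact fun h' => h ⟨y, h'⟩
  let ch : D → ℕ → Option D := fun r k => Nat.rec (some r) (fun _ o => o.bind next) k
  have hsucc : ∀ r k x, ch r k = some x → ch r (k + 1) = next x := fun r k x h => by
    change (ch r k).bind next = next x
    rw [h]
    rfl
  have hof : ∀ r k x, ch r (k + 1) = some x → ∃ y, ch r k = some y ∧ R y x := by
    intro r k x h
    obtain ⟨y, h1, h2⟩ := Option.bind_eq_some_iff.1 (show (ch r k).bind next = some x from h)
    exact ⟨y, h1, (hnext _ _).2 h2⟩
  have hmono : ∀ r k n x y, ch r k = some x → ch r (k + (n + 1)) = some y → x < y := by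
    intro r k n x y hx
    induction n generalizing y with
    | zero =>
      intro hy
      obtain ⟨z, h1, h2⟩ := hof r k y hy
      obtain rfl : z = x := Option.some.inj (h1.symm.trans hx)
      exact hlt _ _ h2
    | succ n ih =>
      intro hy
      obtain ⟨z, h1, h2⟩ := hof r (k + (n + 1)) y hy
      exact (ih z h1).trans (hlt _ _ h2)
  have hchain : ∀ r, (¬ ∃ y, R y r) → IsChain R (ch r) := by
    intro r hr
    refine ⟨fun k x y h => by rw [hsucc r k x h, hnext], fun k x y h hR => ?_,
      fun k x h => (hof r k x h).imp fun _ => And.left, fun k l x hk hl => ?_⟩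
    · cases k with
      | zero =>
        obtain rfl : r = x := Option.some.inj h
        exact absurd ⟨y, hR⟩ hr
      | succ k =>
        obtain ⟨z, h1, h2⟩ := hof r k x h
        obtain rfl := hinj _ _ _ h2 hR
        exact ⟨k, rfl, h1⟩
    · rcases lt_trichotomy k l with h | h | h
      · obtain ⟨n, rfl⟩ := Nat.exists_eq_add_of_lt h
        exact (lt_irrefl x (hmono r k n x x hk (by rwa [add_assoc] at hl))).elim
      · exact h
      · obtain ⟨n, rfl⟩ := Nat.exists_eq_add_of_lt h
        exact (lt_irrefl x (hmono r l n x x hl (by rwa [add_assoc] at hk))).elim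
  suffices h : ∃ r k, (¬ ∃ y, R y r) ∧ ch r k = some x by
    obtain ⟨r, k, hr, hk⟩ := h
    exact ⟨ch r, k, hchain r hr, hk⟩
  induction x using WellFoundedLT.induction with
  | ind x ih =>
    by_cases hx : ∃ y, R y x
    · obtain ⟨y, hy⟩ := hx
      obtain ⟨r, k, hr, hk⟩ := ih y (hlt _ _ hy)
      exact ⟨r, k + 1, hr, (hsucc r k y hk).trans ((hnext _ _).1 hy)⟩
    · exact ⟨x, 0, hx, rfl⟩

section Transfer

variable {𝒟 D : Type*} [LinearOrder D]

/-- The labels of `W` are those of the positions of the chain `c`. -/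
def Represents (w : D → Set Pr × 𝒟) (c : ℕ → Option D) (ρ : ℕ → Set D)
    (W : ℕ → Letter Pr) : Prop :=
  ∀ k, ((W k).alive ↔ ∃ x, c k = some x) ∧ ∀ x, c k = some x →
    (∀ a, (W k).atoms a ↔ a.Holds w x) ∧ ∀ n, (W k).vars n ↔ x ∈ ρ n

theorem Represents.cons {w : D → Set Pr × 𝒟} {c : ℕ → Option D} {ρ : ℕ → Set D}
    {W : ℕ → Letter Pr} (h : Represents w c ρ W) {A : Set D} {A' : Set ℕ}
    (hA : ∀ k x, c k = some x → (k ∈ A' ↔ x ∈ A)) :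
    Represents w c (consVal A ρ) (consWord A' W) := by
  refine fun k => ⟨(h k).1, fun x hx => ⟨((h k).2 x hx).1, fun n => ?_⟩⟩
  cases n with
  | zero => exact hA k x hx
  | succ n => exact ((h k).2 x hx).2 n

/-- The modality follows `R` or its converse. -/
def Follows (w : D → Set Pr × 𝒟) (R : D → D → Prop) (M : Modality) : Prop :=
  (M.Fwd ∧ ∀ x y, M.Step w x y ↔ R x y) ∨ (¬ M.Fwd ∧ ∀ x y, M.Step w x y ↔ R y x)

/-- Modalities following `R` never leave the chain. For fixpoints, sets are carried between the
chain and its indices. What lies off the chain is put into the set for `μ` and left out for `ν`, so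
that the pre- or post-fixed point condition is vacuous there. -/
theorem mem_sem_iff {w : D → Set Pr × 𝒟} {R : D → D → Prop} {c : ℕ → Option D}
    (hc : IsChain R c) {Ms : Set Modality} (hMs : ∀ M ∈ Ms, Follows w R M) {φ : Formula Pr}
    (hφ : φ.UsesOnly Ms) {ρ : ℕ → Set D} {W : ℕ → Letter Pr} (hW : Represents w c ρ W)
    {k : ℕ} {x : D} (hx : c k = some x) : x ∈ φ.sem w ρ ↔ k ∈ φ.wsem W := by
  induction φ generalizing ρ W k x with
  | var n => exact (((hW k).2 x hx).2 n).symm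
  | atom a => exact (((hW k).2 x hx).1 a).symm
  | natom a => exact not_congr (((hW k).2 x hx).1 a).symm
  | modal M φ ih =>
    rcases hMs M hφ.1 with ⟨hM, h⟩ | ⟨hM, h⟩
    · constructor
      · rintro ⟨y, hy, h'⟩
        have hk := (hc.step_iff k x y hx).1 ((h x y).1 hy)
        exact ⟨k + 1, .inl ⟨hM, rfl, (hW _).1.2 ⟨y, hk⟩⟩, (ih hφ.2 hW hk).1 h'⟩
      · rintro ⟨l, ⟨-, rfl, ha⟩ | ⟨hM', -⟩, h'⟩
        · obtain ⟨y, hy⟩ := (hW _).1.1 ha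
          exact ⟨y, (h x y).2 ((hc.step_iff k x y hx).2 hy), (ih hφ.2 hW hy).2 h'⟩
        · exact absurd hM hM'
    · constructor
      · rintro ⟨y, hy, h'⟩
        obtain ⟨l, rfl, hl⟩ := hc.pred k x y hx ((h x y).1 hy)
        exact ⟨l, .inr ⟨hM, rfl⟩, (ih hφ.2 hW hl).1 h'⟩
      · rintro ⟨l, ⟨hM', -⟩ | ⟨-, rfl⟩, h'⟩
        · exact absurd hM' hM
        · obtain ⟨y, hy⟩ := hc.of_succ l x hx
          exact ⟨y, (h x y).2 ((hc.step_iff l y x hy).2 hx), (ih hφ.2 hW hy).2 h'⟩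
  | or φ ψ ih ih' => exact or_congr (ih hφ.1 hW hx) (ih' hφ.2 hW hx)
  | and φ ψ ih ih' => exact and_congr (ih hφ.1 hW hx) (ih' hφ.2 hW hx)
  | mu φ ih =>
    constructor
    · intro h A' hA'
      have hr : ∀ j y, c j = some y → (j ∈ A' ↔ y ∈ {y | ∀ j, c j = some y → j ∈ A'}) :=
        fun j y hj => ⟨fun h i hi => hc.inj j i y hj hi ▸ h, fun h => h j hj⟩
      exact (hr k x hx).2 (h _ fun y hy j hj => hA' ((ih hφ (hW.cons hr) hj).1 hy))
    · intro h A hA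
      have hr : ∀ j y, c j = some y → (j ∈ {j | ∀ y, c j = some y → y ∈ A} ↔ y ∈ A) :=
        fun j y hj => ⟨fun h => h y hj, fun h z hz => Option.some.inj (hj.symm.trans hz) ▸ h⟩
      exact (hr k x hx).1 (h _ fun j hj y hy => hA ((ih hφ (hW.cons hr) hy).2 hj))
  | nu φ ih =>
    constructor
    · rintro ⟨A, hA, hxA⟩
      have hr : ∀ j y, c j = some y → (j ∈ {j | ∃ y, c j = some y ∧ y ∈ A} ↔ y ∈ A) :=
        fun j y hj => ⟨fun ⟨z, hz, h⟩ => Option.some.inj (hz.symm.trans hj) ▸ h,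
          fun h => ⟨y, hj, h⟩⟩
      refine ⟨_, ?_, (hr k x hx).2 hxA⟩
      rintro j ⟨y, hj, hy⟩
      exact (ih hφ (hW.cons hr) hj).1 (hA hy)
    · rintro ⟨A', hA', hk⟩
      have hr : ∀ j y, c j = some y → (j ∈ A' ↔ y ∈ {y | ∃ j, c j = some y ∧ j ∈ A'}) :=
        fun j y hj => ⟨fun h => ⟨j, hj, h⟩, fun ⟨i, hi, h⟩ => hc.inj i j y hi hj ▸ h⟩
      refine ⟨_, ?_, (hr k x hx).1 hk⟩
      rintro y ⟨j, hj, hy⟩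
      exact (ih hφ (hW.cons hr) hj).2 (hA' hy)

/-- The ω-word of the labels along a chain. -/
def chainWord (w : D → Set Pr × 𝒟) (c : ℕ → Option D) (ρ : ℕ → Set D) : ℕ → Letter Pr := fun k =>
  (c k).elim (deadLetter Pr) fun x => ⟨fun a => a.Holds w x, fun n => x ∈ ρ n, True⟩

theorem chainWord_of_some {w : D → Set Pr × 𝒟} {c : ℕ → Option D} {ρ : ℕ → Set D} {k : ℕ} {x : D}
    (h : c k = some x) :
    chainWord w c ρ k = ⟨fun a => a.Holds w x, fun n => x ∈ ρ n, True⟩ := by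
  rw [chainWord, h]
  rfl

theorem chainWord_of_none {w : D → Set Pr × 𝒟} {c : ℕ → Option D} {ρ : ℕ → Set D} {k : ℕ}
    (h : c k = none) : chainWord w c ρ k = deadLetter Pr := by
  rw [chainWord, h]
  rfl

theorem chainWord_alive {w : D → Set Pr × 𝒟} {c : ℕ → Option D} {ρ : ℕ → Set D} {k : ℕ} :
    (chainWord w c ρ k).alive ↔ ∃ x, c k = some x := by
  cases h : c k with
  | none => simp [chainWord_of_none h, deadLetter]
  | some x => simp [chainWord_of_some h]

theorem represents_chainWord (w : D → Set Pr × 𝒟) (c : ℕ → Option D) (ρ : ℕ → Set D) :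
    Represents w c ρ (chainWord w c ρ) := by
  refine fun k => ⟨chainWord_alive, fun x hx => ?_⟩
  rw [chainWord_of_some hx]
  exact ⟨fun _ => Iff.rfl, fun _ => Iff.rfl⟩

theorem isChainWord_chainWord {w : D → Set Pr × 𝒟} {R : D → D → Prop} {c : ℕ → Option D}
    (hc : IsChain R c) (h0 : ∃ x, c 0 = some x) (ρ : ℕ → Set D) {first last : Atom Pr}
    (hfirst : ∀ x, first.Holds w x ↔ ¬ ∃ y, R y x)
    (hlast : ∀ x, last.Holds w x ↔ ¬ ∃ y, R x y) :
    IsChainWord first last (chainWord w c ρ) := by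
  refine ⟨fun k h => ?_, fun k h => ?_, fun k => ?_, fun k => ?_⟩
  · obtain ⟨x, hx⟩ := chainWord_alive.1 h
    exact chainWord_alive.2 (hc.of_succ k x hx)
  · rw [chainWord_alive, ← Option.isSome_iff_exists, Option.not_isSome_iff_eq_none] at h
    exact chainWord_of_none h
  · cases hk : c k with
    | none =>
      rw [chainWord_of_none hk]
      refine ⟨False.elim, ?_⟩
      rintro rfl
      obtain ⟨x, hx⟩ := h0
      simp [hx] at hk
    | some x =>
      rw [chainWord_of_some hk]
      refine (hfirst x).trans ⟨fun h => ?_, ?_⟩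
      · cases k with
        | zero => rfl
        | succ k =>
          obtain ⟨y, hy⟩ := hc.of_succ k x hk
          exact absurd ⟨y, (hc.step_iff k y x hy).2 hk⟩ h
      · rintro rfl ⟨y, hy⟩
        obtain ⟨l, h, -⟩ := hc.pred 0 x y hk hy
        omega
  · rw [chainWord_alive, chainWord_alive]
    cases hk : c k with
    | none => simp [chainWord_of_none hk, deadLetter]
    | some x =>
      rw [chainWord_of_some hk]
      refine (hlast x).trans ?_
      simp only [hc.step_iff k x _ hk, Option.some.injEq, exists_eq', true_and]

end Transfer

section Separation

universe v

/-- Separation over the chains of a relation which a pair of modalities follows. -/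
theorem exists_separation_of_follows (𝒟 : Type v) (φ : Formula Pr) (first last : Atom Pr)
    {X Y : Modality} (hX : X.Fwd) (hY : ¬ Y.Fwd) (hφ : φ.UsesOnly {X, Y}) :
    ∃ l : List (Formula Pr × Formula Pr),
      (∀ p ∈ l, Within {Y} {n | φ.FreeIn n} p.1 ∧ Within {X} {n | φ.FreeIn n} p.2) ∧
      ∀ (D : Type) [LinearOrder D] [WellFoundedLT D] (w : D → Set Pr × 𝒟) (R : D → D → Prop),
        (∀ x y z, R x y → R x z → y = z) → (∀ x y z, R x z → R y z → x = y) →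
        (∀ x y, R x y → x < y) → Follows w R X → Follows w R Y →
        (∀ x, first.Holds w x ↔ ¬ ∃ y, R y x) → (∀ x, last.Holds w x ↔ ¬ ∃ y, R x y) →
        ∀ ρ x, x ∈ φ.sem w ρ ↔ ∃ p ∈ l, x ∈ p.1.sem w ρ ∧ x ∈ p.2.sem w ρ := by
  obtain ⟨l, hl, h⟩ := exists_separation φ first last hX hY
  refine ⟨l, hl, fun D _ _ w R hfun hinj hlt hRX hRY hfirst hlast ρ x => ?_⟩
  obtain ⟨c, k, hc, hk⟩ := exists_isChain hfun hinj hlt x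
  have h0 : ∃ x, c 0 = some x := by
    have : ∀ k x, c k = some x → ∃ x, c 0 = some x := by
      intro k
      induction k with
      | zero => exact fun x hx => ⟨x, hx⟩
      | succ k ih =>
        intro x hx
        obtain ⟨y, hy⟩ := hc.of_succ k x hx
        exact ih y hy
    exact this k x hk
  have hr := represents_chainWord w c ρ
  rw [mem_sem_iff hc (Ms := {X, Y}) (by rintro M (rfl | rfl) <;> assumption) hφ hr hk,
    h _ (isChainWord_chainWord hc h0 ρ hfirst hlast) k (chainWord_alive.2 ⟨x, hk⟩)]
  refine exists_congr fun p => and_congr_right fun hp => and_congr ?_ ?_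
  · exact (mem_sem_iff hc (by rintro M rfl; exact hRY) (hl p hp).1.1 hr hk).symm
  · exact (mem_sem_iff hc (by rintro M rfl; exact hRX) (hl p hp).2.1 hr hk).symm

theorem Within.mono {Ms Ms' : Set Modality} {B : Set ℕ} {φ : Formula Pr} (hM : Ms ⊆ Ms')
    (h : Within Ms B φ) : Within Ms' B φ := by
  refine ⟨?_, h.2⟩
  have h1 := h.1
  clear h
  induction φ with
  | var n => trivial
  | atom a => trivial
  | natom a => trivial
  | modal M φ ih => exact ⟨hM h1.1, ih h1.2⟩
  | or φ ψ ih ih' => exact ⟨ih h1.1, ih' h1.2⟩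
  | and φ ψ ih ih' => exact ⟨ih h1.1, ih' h1.2⟩
  | mu φ ih => exact ih h1
  | nu φ ih => exact ih h1

theorem ClassSucc.right_unique {𝒟 D : Type*} [LinearOrder D] {w : D → Set Pr × 𝒟} {x y z : D}
    (h : ClassSucc w x y) (h' : ClassSucc w x z) : y = z := by
  rcases lt_trichotomy y z with hyz | hyz | hyz
  · exact absurd h.2.1 (h'.2.2 y h.1 hyz)
  · exact hyz
  · exact absurd h'.2.1 (h.2.2 z h'.1 hyz)

theorem ClassSucc.left_unique {𝒟 D : Type*} [LinearOrder D] {w : D → Set Pr × 𝒟} {x y z : D}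
    (h : ClassSucc w x z) (h' : ClassSucc w y z) : x = y := by
  rcases lt_trichotomy x y with hxy | hxy | hxy
  · exact absurd (h'.2.1.symm.trans h.2.1) (h.2.2 y hxy h'.1)
  · exact hxy
  · exact absurd (h.2.1.symm.trans h'.2.1) (h'.2.2 x hxy h.1)

/-- Separation for the formulas from which BMA is generated. -/
theorem exists_separation_bmaBase (𝒟 : Type v) {φ : Formula Pr} (hφ : φ ∈ bmaBase Pr) :
    ∃ l : List (Formula Pr × Formula Pr),
      (∀ p ∈ l, Within {.Yc, .Yg} {n | φ.FreeIn n} p.1 ∧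
        Within {.Xc, .Xg} {n | φ.FreeIn n} p.2) ∧
      ∀ (D : Type) [LinearOrder D] [WellFoundedLT D] [SuccOrder D] [PredOrder D]
        (w : D → Set Pr × 𝒟) ρ x,
        x ∈ φ.sem w ρ ↔ ∃ p ∈ l, x ∈ p.1.sem w ρ ∧ x ∈ p.2.sem w ρ := by
  rcases hφ with hφ | hφ
  · obtain ⟨l, hl, h⟩ := exists_separation_of_follows 𝒟 φ .firstG .lastG (X := .Xg) (Y := .Yg)
      trivial id hφ
    refine ⟨l, fun p hp => ⟨(hl p hp).1.mono (by simp), (hl p hp).2.mono (by simp)⟩,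
      fun D _ _ _ _ w => h D w (fun x y => x ⋖ y) (fun x y z => CovBy.unique_right)
        (fun x y z => CovBy.unique_left) (fun x y => CovBy.lt)
        (.inl ⟨trivial, fun _ _ => Iff.rfl⟩) (.inr ⟨id, fun _ _ => Iff.rfl⟩)
        (fun x => ⟨?_, fun hx => ?_⟩) (fun x => ⟨?_, fun hx => ?_⟩)⟩
    · rintro hx ⟨y, hy⟩
      exact (hx y).not_gt hy.lt
    -- `firstG` speaks of minimality, the chain of lacking a predecessor; `PredOrder` gives every
    -- non-minimal position a predecessor.
    · exact isMin_iff_forall_not_lt.2 (fun y hy => hx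
        ⟨_, Order.pred_covBy_of_not_isMin fun hm => hm.not_lt hy⟩) |>.isBot
    · rintro hx ⟨y, hy⟩
      exact (hx y).not_gt hy.lt
    · exact isMax_iff_forall_not_lt.2 (fun y hy => hx
        ⟨_, Order.covBy_succ_of_not_isMax fun hm => hm.not_lt hy⟩) |>.isTop
  · obtain ⟨l, hl, h⟩ := exists_separation_of_follows 𝒟 φ .firstC .lastC (X := .Xc) (Y := .Yc)
      trivial id hφ
    exact ⟨l, fun p hp => ⟨(hl p hp).1.mono (by simp), (hl p hp).2.mono (by simp)⟩,
      fun D _ _ _ _ w => h D w (ClassSucc w) (fun x y z => ClassSucc.right_unique)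
        (fun x y z => ClassSucc.left_unique) (fun x y => And.left)
        (.inl ⟨trivial, fun _ _ => Iff.rfl⟩) (.inr ⟨id, fun _ _ => Iff.rfl⟩)
        (fun x => Iff.rfl) (fun x => Iff.rfl)⟩

end Separation

/-! ### Substitution -/

section Substitution

theorem rename_subst (φ : Formula Pr) (r : ℕ → ℕ) (σ : ℕ → Formula Pr) :
    (φ.rename r).subst σ = φ.subst fun n => σ (r n) := by
  have key : ∀ (r : ℕ → ℕ) (σ : ℕ → Formula Pr),
      (fun n => liftSubst σ (liftRen r n)) = liftSubst fun n => σ (r n) := by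
    intro r σ
    funext n
    cases n <;> rfl
  induction φ generalizing r σ <;> simp_all [Formula.rename, Formula.subst]

theorem rename_rename (φ : Formula Pr) (r s : ℕ → ℕ) :
    (φ.rename r).rename s = φ.rename fun n => s (r n) := by
  have key : ∀ r s : ℕ → ℕ, (fun n => liftRen s (liftRen r n)) = liftRen fun n => s (r n) := by
    intro r s
    funext n
    cases n <;> rfl
  induction φ generalizing r s <;> simp_all [Formula.rename]

theorem subst_rename (φ : Formula Pr) (σ : ℕ → Formula Pr) (r : ℕ → ℕ) :
    (φ.subst σ).rename r = φ.subst fun n => (σ n).rename r := by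
  have key : ∀ (σ : ℕ → Formula Pr) (r : ℕ → ℕ),
      (fun n => (liftSubst σ n).rename (liftRen r)) = liftSubst fun n => (σ n).rename r := by
    intro σ r
    funext n
    cases n with
    | zero => rfl
    | succ n => simp [liftSubst, rename_rename, liftRen]
  induction φ generalizing r σ <;> simp_all [Formula.rename, Formula.subst]

theorem subst_subst (φ : Formula Pr) (σ τ : ℕ → Formula Pr) :
    (φ.subst σ).subst τ = φ.subst fun n => (σ n).subst τ := by
  have key : ∀ σ τ : ℕ → Formula Pr,
      (fun n => (liftSubst σ n).subst (liftSubst τ)) = liftSubst fun n => (σ n).subst τ := by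
    intro σ τ
    funext n
    cases n with
    | zero => rfl
    | succ n => simp [liftSubst, rename_subst, subst_rename]
  induction φ generalizing σ τ <;> simp_all [Formula.subst]

theorem subst_var_comp (φ : Formula Pr) (r : ℕ → ℕ) :
    (φ.subst fun n => .var (r n)) = φ.rename r := by
  have key : ∀ r : ℕ → ℕ,
      (liftSubst fun n => (.var (r n) : Formula Pr)) = fun n => .var (liftRen r n) := by
    intro r
    funext n
    cases n <;> rfl
  induction φ generalizing r <;> simp_all [Formula.rename, Formula.subst]

theorem subst_var (φ : Formula Pr) : φ.subst .var = φ := by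
  have key : liftSubst (.var : ℕ → Formula Pr) = .var := by
    funext n
    cases n <;> rfl
  induction φ <;> simp_all [Formula.subst]

theorem usesOnly_subst {Ms : Set Modality} {φ : Formula Pr} {σ : ℕ → Formula Pr}
    (hφ : φ.UsesOnly Ms) (hσ : ∀ n, (σ n).UsesOnly Ms) : (φ.subst σ).UsesOnly Ms := by
  have key : ∀ σ : ℕ → Formula Pr, (∀ n, (σ n).UsesOnly Ms) →
      ∀ n, (liftSubst σ n).UsesOnly Ms := by
    intro σ h n
    cases n with
    | zero => trivial
    | succ n => exact usesOnly_rename.2 (h n)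
  induction φ generalizing σ with
  | var n => exact hσ n
  | atom a => trivial
  | natom a => trivial
  | modal M φ ih => exact ⟨hφ.1, ih hφ.2 hσ⟩
  | or φ ψ ih ih' => exact ⟨ih hφ.1 hσ, ih' hφ.2 hσ⟩
  | and φ ψ ih ih' => exact ⟨ih hφ.1 hσ, ih' hφ.2 hσ⟩
  | mu φ ih => exact ih hφ (key σ hσ)
  | nu φ ih => exact ih hφ (key σ hσ)

theorem freeIn_subst {φ : Formula Pr} {σ : ℕ → Formula Pr} {n : ℕ} :
    (φ.subst σ).FreeIn n ↔ ∃ m, φ.FreeIn m ∧ (σ m).FreeIn n := by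
  have key : ∀ (P : ℕ → Prop) (σ : ℕ → Formula Pr) n,
      (∃ m, P m ∧ (liftSubst σ m).FreeIn (n + 1)) ↔ ∃ m, P (m + 1) ∧ (σ m).FreeIn n := by
    intro P σ n
    have e : ∀ m, ((σ m).rename Nat.succ).FreeIn (n + 1) ↔ (σ m).FreeIn n := fun m => by
      simp [freeIn_rename]
    constructor
    · rintro ⟨_ | m, h, h'⟩
      · simp [liftSubst, Formula.FreeIn] at h'
      · exact ⟨m, h, (e m).1 h'⟩
    · rintro ⟨m, h, h'⟩
      exact ⟨m + 1, h, (e m).2 h'⟩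
  induction φ generalizing σ n with
  | var m => simp [Formula.subst, Formula.FreeIn]
  | atom a => simp [Formula.subst, Formula.FreeIn]
  | natom a => simp [Formula.subst, Formula.FreeIn]
  | modal M φ ih => simp only [Formula.subst, Formula.FreeIn, ih]
  | or φ ψ ih ih' => simp only [Formula.subst, Formula.FreeIn, ih, ih', or_and_right, exists_or]
  | and φ ψ ih ih' => simp only [Formula.subst, Formula.FreeIn, ih, ih', or_and_right, exists_or]
  | mu φ ih => simp only [Formula.subst, Formula.FreeIn, ih, key]
  | nu φ ih => simp only [Formula.subst, Formula.FreeIn, ih, key]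

variable {𝒟 D : Type*} [LinearOrder D]

theorem sem_rename (w : D → Set Pr × 𝒟) (φ : Formula Pr) (r : ℕ → ℕ) (ρ : ℕ → Set D) :
    (φ.rename r).sem w ρ = φ.sem w fun n => ρ (r n) := by
  have key : ∀ (A : Set D) (r : ℕ → ℕ) (ρ : ℕ → Set D),
      (fun n => consVal A ρ (liftRen r n)) = consVal A fun n => ρ (r n) := by
    intro A r ρ
    funext n
    cases n <;> rfl
  induction φ generalizing r ρ <;> simp_all [Formula.rename, Formula.sem]

theorem sem_subst (w : D → Set Pr × 𝒟) (φ : Formula Pr) (σ : ℕ → Formula Pr) (ρ : ℕ → Set D) :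
    (φ.subst σ).sem w ρ = φ.sem w fun n => (σ n).sem w ρ := by
  have key : ∀ (A : Set D) (σ : ℕ → Formula Pr) (ρ : ℕ → Set D),
      (fun n => (liftSubst σ n).sem w (consVal A ρ)) = consVal A fun n => (σ n).sem w ρ := by
    intro A σ ρ
    funext n
    cases n with
    | zero => rfl
    | succ n => exact sem_rename w (σ n) _ _
  induction φ generalizing σ ρ <;> simp_all [Formula.subst, Formula.sem]

theorem sem_falsum (w : D → Set Pr × 𝒟) (ρ : ℕ → Set D) : (falsum : Formula Pr).sem w ρ = ∅ :=
  Set.eq_empty_of_subset_empty fun _ h => h ∅ fun _ => id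

theorem mem_sem_bigOr {l : List (Formula Pr)} {w : D → Set Pr × 𝒟} {ρ : ℕ → Set D} {x : D} :
    x ∈ (bigOr l).sem w ρ ↔ ∃ φ ∈ l, x ∈ φ.sem w ρ := by
  induction l with
  | nil => simp [bigOr, sem_falsum]
  | cons φ l ih =>
    rw [bigOr, List.foldr_cons, ← bigOr]
    simp [Formula.sem, ih]

theorem freeIn_bigOr {l : List (Formula Pr)} {n : ℕ} :
    (bigOr l).FreeIn n ↔ ∃ φ ∈ l, φ.FreeIn n := by
  induction l with
  | nil => simp [bigOr, falsum, Formula.FreeIn]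
  | cons φ l ih =>
    rw [bigOr, List.foldr_cons, ← bigOr]
    simp [Formula.FreeIn, ih]

end Substitution

/-! ### Alternation of future and past -/

/-- The future modalities for `true`, the past modalities for `false`. -/
def dirModalities : Bool → Set Modality
  | true => {.Xc, .Xg}
  | false => {.Yc, .Yg}

/-- The compositions of `j` formulas of alternating directions, the outermost one having
direction `d`. -/
def altLevel (Pr : Type*) : Bool → ℕ → Set (Formula Pr)
  | _, 0 => {φ | ∃ n, φ = .var n}
  | d, j + 1 => {χ | ∃ ψ ∈ Formulas Pr (dirModalities d), ∃ σ : ℕ → Formula Pr,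
      (∀ n, σ n ∈ altLevel Pr (!d) j) ∧ χ = ψ.subst σ}

theorem var_mem_altLevel (d : Bool) (j n : ℕ) : (.var n : Formula Pr) ∈ altLevel Pr d j := by
  induction j generalizing d with
  | zero => exact ⟨n, rfl⟩
  | succ j ih => exact ⟨.var 0, trivial, fun _ => .var n, fun _ => ih _, rfl⟩

theorem mem_altLevel_succ {d : Bool} {j : ℕ} {φ : Formula Pr} (h : φ ∈ altLevel Pr (!d) j) :
    φ ∈ altLevel Pr d (j + 1) := ⟨.var 0, trivial, fun _ => φ, fun _ => h, rfl⟩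

/-- Composition with a formula of the outermost direction does not increase the level. -/
theorem subst_mem_altLevel {d : Bool} {j : ℕ} {φ : Formula Pr}
    (hφ : φ ∈ Formulas Pr (dirModalities d)) {σ : ℕ → Formula Pr}
    (hσ : ∀ n, σ n ∈ altLevel Pr d (j + 1)) : φ.subst σ ∈ altLevel Pr d (j + 1) := by
  choose ψ hψ τ hτ e using hσ
  -- The layers `ψ n` come with different substitutions `τ n`. Pairing makes their variables
  -- disjoint, so that a single substitution serves them all.
  refine ⟨φ.subst fun n => (ψ n).rename (Nat.pair n),
    usesOnly_subst hφ fun n => usesOnly_rename.2 (hψ n),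
    fun m => τ m.unpair.1 m.unpair.2, fun m => hτ _ _, ?_⟩
  rw [subst_subst]
  congr 1
  funext n
  rw [e, rename_subst]
  simp

theorem or_mem_altLevel {d : Bool} {j : ℕ} {φ ψ : Formula Pr} (hφ : φ ∈ altLevel Pr d (j + 1))
    (hψ : ψ ∈ altLevel Pr d (j + 1)) : φ.or ψ ∈ altLevel Pr d (j + 1) :=
  subst_mem_altLevel (φ := .or (.var 0) (.var 1)) (σ := fun n => if n = 0 then φ else ψ)
    ⟨trivial, trivial⟩ fun n => by split_ifs <;> assumption

theorem and_mem_altLevel {d : Bool} {j : ℕ} {φ ψ : Formula Pr} (hφ : φ ∈ altLevel Pr d (j + 1))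
    (hψ : ψ ∈ altLevel Pr d (j + 1)) : φ.and ψ ∈ altLevel Pr d (j + 1) :=
  subst_mem_altLevel (φ := .and (.var 0) (.var 1)) (σ := fun n => if n = 0 then φ else ψ)
    ⟨trivial, trivial⟩ fun n => by split_ifs <;> assumption

theorem bigOr_mem_altLevel {d : Bool} {j : ℕ} {l : List (Formula Pr)}
    (hl : ∀ φ ∈ l, φ ∈ altLevel Pr d (j + 1)) : bigOr l ∈ altLevel Pr d (j + 1) := by
  induction l with
  | nil => exact ⟨falsum, trivial, .var, fun _ => var_mem_altLevel _ _ _, rfl⟩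
  | cons φ l ih => exact or_mem_altLevel (hl φ (by simp)) (ih fun ψ hψ => hl ψ (by simp [hψ]))

theorem formulas_dir_subset_brBase (d : Bool) : Formulas Pr (dirModalities d) ⊆ brBase Pr := by
  cases d
  exacts [fun _ => .inr, fun _ => .inl]

/-- Level `0` of the alternation consists of variables while `Comp` starts empty, so the innermost
layer is absorbed as a renaming of a generator. -/
theorem altLevel_subset_comp (d : Bool) (j : ℕ) :
    altLevel Pr d (j + 1) ⊆ Comp (brBase Pr) (j + 1) := by
  induction j generalizing d with
  | zero =>
    rintro _ ⟨ψ, hψ, σ, hσ, rfl⟩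
    choose r hr using hσ
    obtain rfl : σ = fun n => .var (r n) := funext hr
    exact ⟨_, formulas_dir_subset_brBase d (usesOnly_rename.2 hψ), .var, fun n => .inl rfl,
      by rw [subst_var, subst_var_comp]⟩
  | succ j ih =>
    rintro _ ⟨ψ, hψ, σ, hσ, rfl⟩
    exact ⟨ψ, formulas_dir_subset_brBase d hψ, σ, fun n => .inr (ih _ (hσ n)), rfl⟩

universe v

/-- Every composition of `k` formulas of BMA is equivalent to a composition of `k + 1` formulas of
alternating directions, starting in either direction. -/
theorem exists_altLevel_equiv (𝒟 : Type v) (k : ℕ) {φ : Formula Pr}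
    (hφ : φ ∈ Comp (bmaBase Pr) k) (d : Bool) :
    ∃ φ' ∈ altLevel Pr d (k + 1), (∀ n, φ'.FreeIn n → φ.FreeIn n) ∧
      ∀ (D : Type) [LinearOrder D] [WellFoundedLT D] [SuccOrder D] [PredOrder D]
        (w : D → Set Pr × 𝒟) (ρ : ℕ → Set D), φ.sem w ρ = φ'.sem w ρ := by
  induction k generalizing φ d with
  | zero => exact hφ.elim
  | succ k ih =>
    obtain ⟨ψ, hψ, σ, hσ, rfl⟩ := hφ
    have : ∀ n, ∃ χ ∈ altLevel Pr (!d) (k + 1), (∀ m, χ.FreeIn m → (σ n).FreeIn m) ∧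
        ∀ (D : Type) [LinearOrder D] [WellFoundedLT D] [SuccOrder D] [PredOrder D]
          (w : D → Set Pr × 𝒟) (ρ : ℕ → Set D), (σ n).sem w ρ = χ.sem w ρ := by
      intro n
      rcases hσ n with h | h
      · exact ⟨σ n, h ▸ var_mem_altLevel _ _ _, fun _ => id, fun _ _ _ _ _ _ _ => rfl⟩
      · exact ih h (!d)
    choose τ hτ hfree hsem using this
    obtain ⟨l, hl, h⟩ := exists_separation_bmaBase 𝒟 hψ
    have hmem : ∀ e, ∀ χ ∈ Formulas Pr (dirModalities e), χ.subst τ ∈ altLevel Pr d (k + 2) := by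
      intro e χ hχ
      by_cases he : e = d
      · subst he
        exact ⟨χ, hχ, τ, hτ, rfl⟩
      -- This half merges with the outermost layer of the arguments, so it stays at level `k + 1`.
      · obtain rfl : e = !d := Bool.eq_not.2 he
        exact mem_altLevel_succ (subst_mem_altLevel hχ hτ)
    refine ⟨bigOr (l.map fun p => (p.1.subst τ).and (p.2.subst τ)),
      bigOr_mem_altLevel fun χ hχ => ?_, fun n hn => ?_, fun D _ _ _ _ w ρ => ?_⟩
    · obtain ⟨p, hp, rfl⟩ := List.mem_map.1 hχ
      exact and_mem_altLevel (hmem false _ (hl p hp).1.1) (hmem true _ (hl p hp).2.1)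
    · obtain ⟨χ, hχ, hn⟩ := freeIn_bigOr.1 hn
      obtain ⟨p, hp, rfl⟩ := List.mem_map.1 hχ
      rcases hn with hn | hn
      · obtain ⟨m, h1, h2⟩ := freeIn_subst.1 hn
        exact freeIn_subst.2 ⟨m, (hl p hp).1.2 m h1, hfree m n h2⟩
      · obtain ⟨m, h1, h2⟩ := freeIn_subst.1 hn
        exact freeIn_subst.2 ⟨m, (hl p hp).2.2 m h1, hfree m n h2⟩
    · ext x
      rw [mem_sem_bigOr, sem_subst, h D w]
      simp only [List.mem_map, exists_exists_and_eq_and, Formula.sem, Set.mem_inter_iff,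
        sem_subst, fun n => hsem n D w ρ]

/-! ### A lower bound on the height -/

/-- The direction of a modality: `true` for the future. -/
def Modality.dir : Modality → Bool
  | .Xg => true
  | .Xc => true
  | .Yg => false
  | .Yc => false

/-- The largest number of changes of direction along a branch of the formula, `d` being the
direction before the first modality. -/
def Formula.turns : Formula Pr → Bool → ℕ
  | .var _, _ => 0
  | .atom _, _ => 0
  | .natom _, _ => 0
  | .modal M φ, d => (if M.dir = d then 0 else 1) + φ.turns M.dir
  | .or φ ψ, d => max (φ.turns d) (ψ.turns d)
  | .and φ ψ, d => max (φ.turns d) (ψ.turns d)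
  | .mu φ, d => φ.turns d
  | .nu φ, d => φ.turns d

theorem turns_rename (φ : Formula Pr) (r : ℕ → ℕ) (d : Bool) :
    (φ.rename r).turns d = φ.turns d := by
  induction φ generalizing r d with
  | var n => rfl
  | atom a => rfl
  | natom a => rfl
  | modal M φ ih => simp only [Formula.rename, Formula.turns, ih]
  | or φ ψ ih ih' => simp only [Formula.rename, Formula.turns, ih, ih']
  | and φ ψ ih ih' => simp only [Formula.rename, Formula.turns, ih, ih']
  | mu φ ih => simp only [Formula.rename, Formula.turns, ih]
  | nu φ ih => simp only [Formula.rename, Formula.turns, ih]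

theorem dir_eq_of_mem {M : Modality} {e : Bool} (h : M ∈ dirModalities e) : M.dir = e := by
  cases e <;> rcases h with rfl | rfl <;> rfl

/-- The outer formula moves in direction `e` only: a branch can turn once on entering it, and every
other turn occurs inside a substituted formula. -/
theorem turns_subst_le {e : Bool} {φ : Formula Pr} (hφ : φ ∈ Formulas Pr (dirModalities e))
    {σ : ℕ → Formula Pr} {i : ℕ} (hσ : ∀ n d, (σ n).turns d ≤ i) (d : Bool) :
    (φ.subst σ).turns d ≤ (if e = d then 0 else 1) + i := by
  have key : ∀ σ : ℕ → Formula Pr, (∀ n d, (σ n).turns d ≤ i) →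
      ∀ n d, (liftSubst σ n).turns d ≤ i := by
    intro σ h n d
    cases n with
    | zero => exact Nat.zero_le _
    | succ n => exact (turns_rename _ _ _).trans_le (h n d)
  induction φ generalizing σ d with
  | var n => exact (hσ n d).trans (Nat.le_add_left _ _)
  | atom a => exact Nat.zero_le _
  | natom a => exact Nat.zero_le _
  | modal M φ ih =>
    have h1 := dir_eq_of_mem hφ.1
    have h2 := ih hφ.2 hσ e
    rw [if_pos rfl, zero_add] at h2
    rw [Formula.subst, Formula.turns, h1]
    exact Nat.add_le_add_left h2 _
  | or φ ψ ih ih' => exact max_le (ih hφ.1 hσ d) (ih' hφ.2 hσ d)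
  | and φ ψ ih ih' => exact max_le (ih hφ.1 hσ d) (ih' hφ.2 hσ d)
  | mu φ ih => exact ih hφ (key σ hσ) d
  | nu φ ih => exact ih hφ (key σ hσ) d

theorem turns_le_of_mem_comp {i : ℕ} {φ : Formula Pr} (h : φ ∈ Comp (brBase Pr) i) (d : Bool) :
    φ.turns d ≤ i := by
  induction i generalizing φ d with
  | zero => exact h.elim
  | succ i ih =>
    obtain ⟨ψ, hψ, σ, hσ, rfl⟩ := h
    have hσ' : ∀ n d, (σ n).turns d ≤ i := by
      intro n d
      rcases hσ n with h | h
      · rw [h]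
        exact Nat.zero_le _
      · exact ih h d
    obtain ⟨e, he⟩ : ∃ e, ψ ∈ Formulas Pr (dirModalities e) := by
      rcases hψ with hψ | hψ
      exacts [⟨true, hψ⟩, ⟨false, hψ⟩]
    have := turns_subst_le he hσ' d
    split_ifs at this <;> omega

/-- A chain of `j` modalities of alternating directions that holds nowhere. -/
def zigzag (Pr : Type*) : Bool → ℕ → Formula Pr
  | _, 0 => falsum
  | d, j + 1 => .modal (if d then .Xg else .Yg) (zigzag Pr (!d) j)

/-- Counting from the opposite direction makes the first modality a turn too, so all `j` modalities
count. -/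
theorem turns_zigzag (d : Bool) (j : ℕ) : (zigzag Pr d j).turns (!d) = j := by
  induction j generalizing d with
  | zero => rfl
  | succ j ih =>
    have := ih (!d)
    cases d <;> simp_all [zigzag, Formula.turns, Modality.dir, add_comm]

theorem zigzag_mem_altLevel (d : Bool) (j : ℕ) : zigzag Pr d (j + 1) ∈ altLevel Pr d (j + 1) := by
  have hM : (if d then Modality.Xg else Modality.Yg) ∈ dirModalities d := by
    cases d <;> simp [dirModalities]
  cases j with
  | zero => exact ⟨zigzag Pr d 1, ⟨hM, trivial⟩, .var, fun n => ⟨n, rfl⟩, (subst_var _).symm⟩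
  | succ j =>
    exact ⟨.modal (if d then .Xg else .Yg) (.var 0), ⟨hM, trivial⟩,
      fun _ => zigzag Pr (!d) (j + 1), fun _ => zigzag_mem_altLevel (!d) j, rfl⟩

theorem not_freeIn_zigzag (d : Bool) (j n : ℕ) : ¬ (zigzag Pr d j).FreeIn n := by
  induction j generalizing d with
  | zero => simp [zigzag, falsum, Formula.FreeIn]
  | succ j ih => exact ih _

theorem sem_zigzag {𝒟 D : Type*} [LinearOrder D] (w : D → Set Pr × 𝒟) (ρ : ℕ → Set D) (d : Bool)
    (j : ℕ) : (zigzag Pr d j).sem w ρ = ∅ := by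
  induction j generalizing d with
  | zero => exact sem_falsum w ρ
  | succ j ih => simp [zigzag, Formula.sem, ih]

end DataMu

/-- Every BMA formula of Comp-height `k` is equivalent, over data words and data ω-words, to a BR
formula of Comp-height `k + 1` (with no further free variables). -/
theorem mainTheorem4 {Pr 𝒟 : Type*} (k : ℕ) (φ : DataMu.Formula Pr)
    (hφ : DataMu.HasCompHeight (DataMu.bmaBase Pr) φ k) :
    ∃ φ' : DataMu.Formula Pr,
      DataMu.HasCompHeight (DataMu.brBase Pr) φ' (k + 1) ∧
      (∀ n, φ'.FreeIn n → φ.FreeIn n) ∧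
      DataMu.EquivOnDataWords 𝒟 φ φ' ∧
      DataMu.EquivOnDataOmegaWords 𝒟 φ φ' := by
  obtain ⟨φ', hmem, hfree, hsem⟩ := DataMu.exists_altLevel_equiv 𝒟 k hφ.1 true
  -- The added disjunct is closed and empty, hence changes neither the meaning nor the free
  -- variables, but its `k + 1` turns exclude any smaller height.
  refine ⟨φ'.or (DataMu.zigzag Pr true (k + 1)), ⟨?_, fun i hi => ?_⟩, fun n hn => ?_,
    fun n w ρ => ?_, fun w ρ => ?_⟩
  · exact DataMu.altLevel_subset_comp true k
      (DataMu.or_mem_altLevel hmem (DataMu.zigzag_mem_altLevel true k))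
  · have h := DataMu.turns_le_of_mem_comp hi (!true)
    exact ((DataMu.turns_zigzag (Pr := Pr) true (k + 1)).symm.le.trans (le_max_right _ _)).trans h
  · exact hn.elim (hfree n) fun h => absurd h (DataMu.not_freeIn_zigzag _ _ _)
  · rw [DataMu.Formula.sem, DataMu.sem_zigzag, Set.union_empty, hsem (Fin n)]
  · rw [DataMu.Formula.sem, DataMu.sem_zigzag, Set.union_empty, hsem ℕ]
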